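/- Let $\Omega\subset\mathbb C^n$ be a bounded pseudo-convex domain with smooth boundary, let $0<s\le 1$, and let $\rho$ be a smooth defining function of $\Omega$ on a neighbourhood $U$ of $\overline\Omega$ (so $\Omega=\{z\in U:\rho(z)<0\}$ and $\nabla\rho\neq0$ on $\partial\Omega$) such that $-(-\rho)^s$ is strictly plurisubharmonic in $\Omega$. For a function $h$ on $\mathbb C^m$ put $$\widetilde\Omega=\{(z,w)\in U\times\mathbb C^m:\ \rho(z)+h(w)<0\}.$$ The order $\mathrm{ord}_0(g)$ of a smooth map $g$ at the origin is the smallest order of a partial derivative of $g$ that does not vanish at $0$ ($\infty$ if there is none). The type at a point $z_0$ of a smooth real function $k$ defined near $z_0\in\mathbb C^d$ is $$\mathrm{typ}_{z_0}(k)=\sup_\varphi\frac{\mathrm{ord}_0\big(k(z_0+\varphi)\big)}{\mathrm{ord}_0(\varphi)},$$ the supremum being over all non-zero holomorphic maps $\varphi$ from the unit disc to $\mathbb C^d$ with $\varphi(0)=0$; $k$ is of finite type at $z_0$ if this is finite. The boundary of a domain is of finite type $\tau$ at a smooth boundary point $p$ if $\tau=\mathrm{typ}_p(r)<\infty$ for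 a smooth local defining function $r$ of the domain near $p$ (the value is independent of $r$). A domain with smooth boundary is pseudo-convex (strictly pseudo-convex at $p$) if the Levi form of a local defining function is non-negative on the complex tangent space at every boundary point (positive definite on the complex tangent space at $p$). Call a smooth function $h\ge0$ on $\mathbb C^m$ admissible if $h(w)=0\Leftrightarrow w=0$, $\nabla h(w)\ne0$ for $w\neq0$, and $h(w)\to+\infty$ as $|w|\to\infty$. (1) (Condition I) Let $h$ be admissible and suppose that for some $s'\in[0,s)$ the function $h^{s'}$ is plurisubharmonic, in the sense that $i\partial\bar\partial h\ge i\frac{1-s'}{h}\,\partial h\wedge\bar\partial h$ outside the origin (for $s'=0$: $\log h$ is plurisubharmonic). (a) If $z^0\in\partial\Omega$, $\partial\Omega$ is of finite type $\tau$ at $z^0$ and $h$ is of finite type at the origin, then $\partial\widetilde\Omega$ is of finite type $\max(\tau,\mathrm{typ}_0(h))$ at $(z^0,0)$. (b) If $h$ is strictly plurisubharmonic on $\mathbb C^m\setminus\{0\}$, then $\partial\widetilde\Omega$ is strictly pseudo-convex at every boundary point $(z^0,w^0)$ with $w^0\neq0$. (2) (Condition II) Let $h(w)=\sum_{i=1}^p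 h_i(w_i)$, $w=(w_1,\dots,w_p)$, $w_i\in\mathbb C^{m_i}$, $m_i\ge1$, where each $h_i$ is admissible and plurisubharmonic on $\mathbb C^{m_i}$, strictly plurisubharmonic outside the origin, and of finite type at the origin, and $\log h_i$ is plurisubharmonic. Then $\widetilde\Omega$ is pseudo-convex, and at every $(z^0,w^0)\in\partial\widetilde\Omega$ with $w^0\ne0$: (a) if $w^0_i=0$ for some $i$, then $\partial\widetilde\Omega$ is of finite type $\max_{i:\,w_i^0=0}\mathrm{typ}_0(h_i)$ at $(z^0,w^0)$; (b) if $w_i^0\neq0$ for all $i$, then $\partial\widetilde\Omega$ is strictly pseudo-convex at $(z^0,w^0)$. -/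

import Mathlib

open Set Filter Topology
open scoped ENNReal ContDiff

noncomputable section

namespace Hartogs

/-- The complex Euclidean space `ℂⁿ`. -/
abbrev Cn (n : ℕ) : Type := EuclideanSpace ℂ (Fin n)

section General

variable {V : Type*} [NormedAddCommGroup V] [NormedSpace ℂ V]

/-- The Levi form `⟨∂∂̄f(z); t, t̄⟩ = ∑ (∂²f/∂z_j∂z̄_k)(z) t_j t̄_k` of a real function, written
through the real second derivative: a quarter of the Laplacian of `ζ ↦ f (z + ζ t)` at `0`. -/
def levi (f : V → ℝ) (z t : V) : ℝ :=
  (fderiv ℝ (fderiv ℝ f) z t t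
    + fderiv ℝ (fderiv ℝ f) z (Complex.I • t) (Complex.I • t)) / 4

/-- `f` is of class `C²` and plurisubharmonic on the open set `W`. -/
def IsPSHOn (f : V → ℝ) (W : Set V) : Prop :=
  ContDiffOn ℝ 2 f W ∧ ∀ z ∈ W, ∀ t : V, 0 ≤ levi f z t

/-- `f` is of class `C²` and strictly plurisubharmonic on the open set `W`. -/
def IsStrictPSHOn (f : V → ℝ) (W : Set V) : Prop :=
  ContDiffOn ℝ 2 f W ∧ ∀ z ∈ W, ∀ t : V, t ≠ 0 → 0 < levi f z t

/-- The vector `t` satisfies `⟨∂r(p), t⟩ = ∑ (∂r/∂z_j)(p) t_j = 0`, that is, both `t` and `i t` are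
tangent to the level set of `r` at `p`. -/
def IsComplexTangent (r : V → ℝ) (p t : V) : Prop :=
  fderiv ℝ r p t = 0 ∧ fderiv ℝ r p (Complex.I • t) = 0

/-- `r` is a smooth defining function of `Ω` in a neighbourhood of the boundary point `p`. -/
def IsLocalDefiningFunction (Ω : Set V) (p : V) (r : V → ℝ) : Prop :=
  ∃ W : Set V, IsOpen W ∧ p ∈ W ∧ ContDiffOn ℝ ∞ r W ∧ (∀ x ∈ W, x ∈ Ω ↔ r x < 0) ∧
    r p = 0 ∧ fderiv ℝ r p ≠ 0

/-- `Ω` has smooth boundary and is (Levi) pseudo-convex: at every boundary point the Levi form of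
a defining function is non-negative on the complex tangent space (this does not depend on the
defining function). -/
def IsPseudoconvex (Ω : Set V) : Prop :=
  ∀ p ∈ frontier Ω, ∃ r : V → ℝ, IsLocalDefiningFunction Ω p r ∧
    ∀ t : V, IsComplexTangent r p t → 0 ≤ levi r p t

/-- `∂Ω` is smooth near `p` and strictly pseudo-convex at `p`. -/
def IsStrictPseudoconvexAt (Ω : Set V) (p : V) : Prop :=
  ∃ r : V → ℝ, IsLocalDefiningFunction Ω p r ∧
    ∀ t : V, IsComplexTangent r p t → t ≠ 0 → 0 < levi r p t

/-- The order at the origin of a function of one complex (two real) variables: the smallest order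
of a non-vanishing derivative at `0`, and `∞` if all derivatives vanish there. -/
def ord₀ {F : Type*} [NormedAddCommGroup F] [NormedSpace ℝ F] (g : ℂ → F) : ℕ∞ :=
  ⨅ (k : ℕ) (_ : iteratedFDeriv ℝ k g 0 ≠ 0), (k : ℕ∞)

/-- Non-zero holomorphic maps `φ` of the unit disc into `V` with `φ(0) = 0`. -/
def IsDisc (φ : ℂ → V) : Prop :=
  DifferentiableOn ℂ φ (Metric.ball 0 1) ∧ φ 0 = 0 ∧ ∃ ζ ∈ Metric.ball (0 : ℂ) 1, φ ζ ≠ 0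

/-- The type `typ_z(k)` of a function `k` at the point `z`: the supremum of
`ord₀ (k(z + φ)) / ord₀ φ` over all non-zero holomorphic discs `φ` with `φ(0) = 0`. -/
def typ (k : V → ℝ) (z : V) : ℝ≥0∞ :=
  ⨆ (φ : ℂ → V) (_ : IsDisc φ),
    (ord₀ (fun ζ => k (z + φ ζ)) : ℝ≥0∞) / (ord₀ φ : ℝ≥0∞)

/-- `∂Ω` is of finite (D'Angelo) type `τ` at the boundary point `p`: the type of a defining
function at `p` is `τ < ∞` (the value does not depend on the defining function). -/
def IsOfFiniteType (Ω : Set V) (p : V) (τ : ℝ≥0∞) : Prop :=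
  τ < ⊤ ∧ ∃ r : V → ℝ, IsLocalDefiningFunction Ω p r ∧ typ r p = τ

/-- `Ω` is a smoothly bounded pseudo-convex domain. -/
structure IsSmoothBoundedPseudoconvexDomain (Ω : Set V) : Prop where
  isOpen : IsOpen Ω
  isConnected : IsConnected Ω
  isBounded : Bornology.IsBounded Ω
  pseudoconvex : IsPseudoconvex Ω

/-- `ρ` is a smooth defining function of `Ω`, defined on the open neighbourhood `U` of the closure
of `Ω` (possibly the whole space). -/
structure IsDefiningFunction (Ω U : Set V) (ρ : V → ℝ) : Prop where
  isOpen : IsOpen U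
  closure_subset : closure Ω ⊆ U
  smooth : ContDiffOn ℝ ∞ ρ U
  eq : Ω = {z ∈ U | ρ z < 0}
  gradient : ∀ z ∈ frontier Ω, fderiv ℝ ρ z ≠ 0

/-- The function `-(-ρ)^s` is strictly plurisubharmonic in `Ω`, where `0 < s ≤ 1`. -/
structure IsDiederichFornaess (Ω : Set V) (ρ : V → ℝ) (s : ℝ) : Prop where
  pos : 0 < s
  le_one : s ≤ 1
  strictPSH : IsStrictPSHOn (fun z => -(-ρ z) ^ s) Ω

/-- `h` is smooth, non-negative, vanishes exactly at `0`, has no critical point other than `0` and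
tends to `+∞` at infinity. -/
structure IsAdmissible (h : V → ℝ) : Prop where
  smooth : ContDiff ℝ ∞ h
  nonneg : ∀ w, 0 ≤ h w
  eq_zero_iff : ∀ w, h w = 0 ↔ w = 0
  gradient : ∀ w, w ≠ 0 → fderiv ℝ h w ≠ 0
  tendsto : Tendsto h (cocompact V) atTop

/-- The function `h^σ` is plurisubharmonic, with the usual convention that for `σ = 0` this means
that `log h` is plurisubharmonic; that is, `i∂∂̄h ≥ i (1 - σ)/h ∂h ∧ ∂̄h`. As `h` has its minimum
`0` at the origin, there is nothing to require there. -/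
def PowerIsPSH (h : V → ℝ) (σ : ℝ) : Prop :=
  if σ = 0 then IsPSHOn (fun w => Real.log (h w)) {0}ᶜ
  else IsPSHOn (fun w => h w ^ σ) {0}ᶜ

/-- Condition I on `h`, for the exponent `s` of the Diederich-Fornæss defining function. -/
structure ConditionI (s : ℝ) (h : V → ℝ) : Prop where
  admissible : IsAdmissible h
  psh : ∃ s' : ℝ, 0 ≤ s' ∧ s' < s ∧ PowerIsPSH h s'

end General

/-- Condition II on the summands `h_i` of `h(w) = ∑ h_i(w_i)`, `w_i ∈ ℂ^{m_i}`, `m_i ≥ 1`. -/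
structure ConditionII {p : ℕ} {m : Fin p → ℕ} (h : ∀ i, Cn (m i) → ℝ) : Prop where
  dim_pos : ∀ i, 1 ≤ m i
  admissible : ∀ i, IsAdmissible (h i)
  psh : ∀ i, IsPSHOn (h i) univ
  log_psh : ∀ i, IsPSHOn (fun w => Real.log (h i w)) {0}ᶜ
  strictPSH : ∀ i, IsStrictPSHOn (h i) {0}ᶜ
  finiteType : ∀ i, typ (h i) 0 < ⊤

/-- The function `h(w) = ∑ h_i(w_i)` on `∏ ℂ^{m_i}`. -/
def sumFun {p : ℕ} {m : Fin p → ℕ} (h : ∀ i, Cn (m i) → ℝ) (w : ∀ i, Cn (m i)) : ℝ :=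
  ∑ i, h i (w i)

/-- The Hartogs domain `Ω̃ = {(z, w) : ρ(z) + h(w) < 0}` (`ρ` being defined on `U`). -/
def tilde {E F : Type*} (U : Set E) (ρ : E → ℝ) (h : F → ℝ) : Set (E × F) :=
  {q | q.1 ∈ U ∧ ρ q.1 + h q.2 < 0}

end Hartogs

end

/-!
The boundary of `tilde U ρ h` is given by `ρ(z) + h(w) = 0`. That `-(-ρ)^s` is strictly
plurisubharmonic means `-ρ ∂∂̄ρ > -(1 - s) |∂ρ|²`, and that `h^σ` is plurisubharmonic means
`h ∂∂̄h ≥ (1 - σ) |∂h|²`. On a complex tangent vector at a boundary point `-ρ = h` and `∂ρ = -∂h`,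
so the two add up to a Levi form of at least `(s - σ) |∂h|² / h`.

Along a holomorphic disc the same computation, with `ρ + h` as an error term, shows that `ρ` and
`h` cannot cancel: if `ρ + h` vanishes to order `N`, so do `h` and hence `ρ`. So the type of the
sum is the larger of the two types.

If some coordinates `w_i` of a boundary point vanish and others do not, then the sum `f` of `ρ` and
the `h_i` of the nonzero coordinates is strictly pseudo-convex. Its zero set thus has type at most
`2`, and since `∂∂̄f ≥ -A |∂f|²` near the point for some `A`, while `-f` is small there, `f`
satisfies the inequality for `ρ` with `s = 1/2`. The argument along discs now applies to `f` plus
the `h_i` of the vanishing coordinates, with `σ = 0`.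
-/

open Asymptotics

namespace Hartogs

section VanishingOrder

/-- `f` vanishes at the origin to order at least `N`. This is a bound rather than a condition on
derivatives, so that it applies to non-smooth functions such as `‖f‖`; for smooth functions on `ℂ`
it means `N ≤ ord₀ f`. -/
def VanishesToOrder {E F : Type*} [Norm E] [Zero E] [TopologicalSpace E] [Norm F] (f : E → F)
    (N : ℕ) : Prop :=
  f =O[𝓝 0] fun x => ‖x‖ ^ N

variable {E F G : Type*} [NormedAddCommGroup E] [NormedAddCommGroup F] [NormedAddCommGroup G]
  {f : E → F} {M N : ℕ}

theorem isBigO_norm_pow_norm_pow (h : N ≤ M) :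
    (fun x : E => ‖x‖ ^ M) =O[𝓝 0] fun x => ‖x‖ ^ N := by
  rcases h.eq_or_lt with rfl | h
  · exact isBigO_refl _ _
  · exact (isLittleO_norm_pow_norm_pow h).isBigO

namespace VanishesToOrder

theorem mono (hf : VanishesToOrder f M) (h : N ≤ M) : VanishesToOrder f N :=
  hf.trans (isBigO_norm_pow_norm_pow h)

theorem isLittleO (hf : VanishesToOrder f M) (h : N < M) : f =o[𝓝 0] fun x => ‖x‖ ^ N :=
  hf.trans_isLittleO (isLittleO_norm_pow_norm_pow h)

theorem add {g : E → F} (hf : VanishesToOrder f N) (hg : VanishesToOrder g N) :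
    VanishesToOrder (fun x => f x + g x) N :=
  IsBigO.add hf hg

theorem of_norm_le {g : E → G} (hf : VanishesToOrder f N) (C : ℝ)
    (h : ∀ᶠ x in 𝓝 0, ‖g x‖ ≤ C * ‖f x‖) : VanishesToOrder g N :=
  (IsBigO.of_bound C h).trans hf

theorem norm (hf : VanishesToOrder f N) : VanishesToOrder (fun x => ‖f x‖) N :=
  hf.norm_left

theorem pow {f : E → ℝ} (hf : VanishesToOrder f N) (k : ℕ) :
    VanishesToOrder (fun x => f x ^ k) (k * N) := by
  simpa only [VanishesToOrder, ← pow_mul, mul_comm N k] using IsBigO.pow hf k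

theorem mul {f g : E → ℝ} (hf : VanishesToOrder f M) (hg : VanishesToOrder g N) :
    VanishesToOrder (fun x => f x * g x) (M + N) := by
  simpa only [VanishesToOrder, pow_add] using IsBigO.mul hf hg

theorem const_mul {f : E → ℝ} (hf : VanishesToOrder f N) (c : ℝ) :
    VanishesToOrder (fun x => c * f x) N :=
  IsBigO.const_mul_left hf c

end VanishesToOrder

theorem vanishesToOrder_zero (hf : ContinuousAt f 0) : VanishesToOrder f 0 := by
  simpa only [VanishesToOrder, pow_zero] using hf.isBigO_one ℝ

theorem eventually_forall_closedBall {p : E → Prop} (h : ∀ᶠ x in 𝓝 0, p x) :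
    ∀ᶠ x in 𝓝 0, ∀ y ∈ Metric.closedBall x ‖x‖, p y ∧ ‖y‖ ≤ 2 * ‖x‖ := by
  obtain ⟨δ, hδ, hp⟩ := Metric.eventually_nhds_iff_ball.1 h
  filter_upwards [Metric.ball_mem_nhds (0 : E) (half_pos hδ)] with x hx y hy
  rw [mem_ball_zero_iff] at hx
  have hy2 : ‖y‖ ≤ 2 * ‖x‖ := by
    linarith [norm_le_of_mem_closedBall hy]
  exact ⟨hp y (by rw [mem_ball_zero_iff]; linarith), hy2⟩

variable [NormedSpace ℝ E] [NormedSpace ℝ F]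

theorem contDiffAt_fderiv {x : E} (hf : ContDiffAt ℝ ∞ f x) : ContDiffAt ℝ ∞ (fderiv ℝ f) x :=
  hf.fderiv_right (by simp)

theorem eventually_contDiffAt_two {x : E} (hf : ContDiffAt ℝ ∞ f x) :
    ∀ᶠ y in 𝓝 x, ContDiffAt ℝ 2 f y :=
  (hf.of_le ENat.LEInfty.out).eventually (by simp)

theorem eventually_differentiableAt {𝕜 E F : Type*} [NontriviallyNormedField 𝕜]
    [NormedAddCommGroup E] [NormedSpace 𝕜 E] [NormedAddCommGroup F] [NormedSpace 𝕜 F] {f : E → F}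
    {x : E} {n : WithTop ℕ∞} (hf : ContDiffAt 𝕜 n f x) (hn : 1 ≤ n) :
    ∀ᶠ y in 𝓝 x, DifferentiableAt 𝕜 f y :=
  ((hf.of_le hn).eventually (by simp)).mono fun _ h => h.differentiableAt one_ne_zero

theorem VanishesToOrder.of_fderiv (hf : ∀ᶠ x in 𝓝 0, DifferentiableAt ℝ f x) (h0 : f 0 = 0)
    (hD : VanishesToOrder (fderiv ℝ f) N) : VanishesToOrder f (N + 1) := by
  obtain ⟨C, hC, hb⟩ := hD.exists_nonneg
  refine IsBigO.of_bound (C * 2 ^ N) ?_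
  filter_upwards [eventually_forall_closedBall (hb.bound.and hf)] with x hx
  have hmean := (convex_closedBall x ‖x‖).norm_image_sub_le_of_norm_fderiv_le (𝕜 := ℝ)
    (f := f) (C := C * (2 * ‖x‖) ^ N) (x := 0) (y := x) (fun y hy => (hx y hy).1.2)
    (fun y hy => ?_) (by simp) (by simp)
  · simpa [h0, pow_succ, mul_pow, mul_assoc] using hmean
  · refine (hx y hy).1.1.trans ?_
    rw [Real.norm_of_nonneg (by positivity)]
    gcongr
    exact (hx y hy).2

theorem norm_fderiv_le_of_norm_le_of_norm_fderiv_fderiv_le {x : E} {r A B : ℝ} (hr : 0 < r)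
    (hf : ∀ y ∈ Metric.closedBall x r, DifferentiableAt ℝ f y)
    (hf' : ∀ y ∈ Metric.closedBall x r, DifferentiableAt ℝ (fderiv ℝ f) y)
    (hA : ∀ y ∈ Metric.closedBall x r, ‖f y‖ ≤ A)
    (hB : ∀ y ∈ Metric.closedBall x r, ‖fderiv ℝ (fderiv ℝ f) y‖ ≤ B) :
    ‖fderiv ℝ f x‖ ≤ 2 * A / r + B * r := by
  have hx : x ∈ Metric.closedBall x r := Metric.mem_closedBall_self hr.le
  have hA0 : 0 ≤ A := (norm_nonneg _).trans (hA x hx)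
  have hB0 : 0 ≤ B := (norm_nonneg (fderiv ℝ (fderiv ℝ f) x)).trans (hB x hx)
  have hfderiv : ∀ y ∈ Metric.closedBall x r, ‖fderiv ℝ f y - fderiv ℝ f x‖ ≤ B * r := by
    intro y hy
    refine ((convex_closedBall x r).norm_image_sub_le_of_norm_fderiv_le hf' hB hx hy).trans ?_
    gcongr
    exact mem_closedBall_iff_norm.1 hy
  refine ContinuousLinearMap.opNorm_le_of_unit_norm (by positivity) fun u hu => ?_
  have hu' : ‖r • u‖ = r := by rw [norm_smul, hu, mul_one, Real.norm_of_nonneg hr.le]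
  have hy : x + r • u ∈ Metric.closedBall x r := by
    rw [mem_closedBall_iff_norm, add_sub_cancel_left, hu']
  have hTaylor := (convex_closedBall x r).norm_image_sub_le_of_norm_fderiv_le' hf hfderiv hx hy
  rw [add_sub_cancel_left, hu', map_smul] at hTaylor
  have hsmul : r * ‖fderiv ℝ f x u‖ ≤ 2 * A + B * r * r := by
    calc r * ‖fderiv ℝ f x u‖
        = ‖(f (x + r • u) - f x) - (f (x + r • u) - f x - r • fderiv ℝ f x u)‖ := by
          rw [sub_sub_cancel, norm_smul, Real.norm_of_nonneg hr.le]
      _ ≤ ‖f (x + r • u)‖ + ‖f x‖ + ‖f (x + r • u) - f x - r • fderiv ℝ f x u‖ :=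
          (norm_sub_le _ _).trans (by gcongr; exact norm_sub_le _ _)
      _ ≤ 2 * A + B * r * r := by linarith [hA _ hx, hA _ hy]
  rw [div_add' _ _ _ hr.ne', le_div_iff₀ hr]
  linarith

theorem isLittleO_fderiv (hf : ∀ᶠ x in 𝓝 0, DifferentiableAt ℝ f x)
    (hf' : ∀ᶠ x in 𝓝 0, DifferentiableAt ℝ (fderiv ℝ f) x)
    (ho : f =o[𝓝 0] fun x => ‖x‖ ^ (N + 2))
    (h2 : VanishesToOrder (fderiv ℝ (fderiv ℝ f)) N) :
    fderiv ℝ f =o[𝓝 0] fun x => ‖x‖ ^ (N + 1) := by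
  have h0 : fderiv ℝ f 0 = 0 :=
    (ho.isBigO.congr_right fun x => by rw [sub_zero]).hasFDerivAt (by omega) |>.fderiv
  rw [isLittleO_iff]
  intro η hη
  obtain ⟨C, hC, hb⟩ := h2.exists_pos
  obtain ⟨ε, hε, hε1, hεη⟩ : ∃ ε : ℝ, 0 < ε ∧ ε ≤ 1 ∧ C * 2 ^ N * ε ≤ η / 2 :=
    ⟨min 1 (η / 2 / (C * 2 ^ N)), by positivity, min_le_left _ _,
      (le_div_iff₀' (by positivity)).1 (min_le_right _ _)⟩
  obtain ⟨κ, hκ, hκη⟩ : ∃ κ : ℝ, 0 < κ ∧ 2 ^ (N + 3) * κ / ε = η / 2 :=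
    ⟨η / 2 * ε / 2 ^ (N + 3), by positivity, by field_simp⟩
  filter_upwards [eventually_forall_closedBall
    (((hf.and hf').and hb.bound).and (isLittleO_iff.1 ho hκ))] with x hx
  rcases eq_or_ne x 0 with rfl | hx0
  · simp [h0]
  have hn : 0 < ‖x‖ := norm_pos_iff.2 hx0
  have hsub : Metric.closedBall x (ε * ‖x‖) ⊆ Metric.closedBall x ‖x‖ :=
    Metric.closedBall_subset_closedBall (mul_le_of_le_one_left hn.le hε1)
  rw [norm_pow, norm_norm]
  calc ‖fderiv ℝ f x‖
      ≤ 2 * (κ * (2 * ‖x‖) ^ (N + 2)) / (ε * ‖x‖) + C * (2 * ‖x‖) ^ N * (ε * ‖x‖) := by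
        refine norm_fderiv_le_of_norm_le_of_norm_fderiv_fderiv_le (by positivity)
          (fun y hy => (hx y (hsub hy)).1.1.1.1) (fun y hy => (hx y (hsub hy)).1.1.1.2)
          (fun y hy => (hx y (hsub hy)).1.2.trans ?_) fun y hy => (hx y (hsub hy)).1.1.2.trans ?_
        all_goals
          rw [norm_pow, norm_norm]
          gcongr
          exact (hx y (hsub hy)).2
    _ = 2 ^ (N + 3) * κ / ε * ‖x‖ ^ (N + 1) + C * 2 ^ N * ε * ‖x‖ ^ (N + 1) := by
        field_simp
        ring
    _ ≤ η / 2 * ‖x‖ ^ (N + 1) + η / 2 * ‖x‖ ^ (N + 1) := by rw [hκη]; gcongr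
    _ = η * ‖x‖ ^ (N + 1) := by ring

theorem fderiv_eq_zero_of_isLittleO (ho : f =o[𝓝 0] fun x => ‖x‖) : fderiv ℝ f 0 = 0 := by
  have h0 : f 0 = 0 := by simpa using ho.isBigO.eq_zero_imp.self_of_nhds
  have : HasFDerivAt f (0 : E →L[ℝ] F) 0 := by
    rw [hasFDerivAt_iff_isLittleO]
    simpa [h0] using ho.of_norm_right
  exact this.fderiv

theorem iteratedFDeriv_succ_eq_zero_iff {x : E} {k : ℕ} :
    iteratedFDeriv ℝ (k + 1) f x = 0 ↔ iteratedFDeriv ℝ k (fderiv ℝ f) x = 0 := by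
  rw [← norm_eq_zero, ← norm_iteratedFDeriv_fderiv, norm_eq_zero]

theorem iteratedFDeriv_zero_eq_zero_iff {x : E} : iteratedFDeriv ℝ 0 f x = 0 ↔ f x = 0 := by
  rw [← norm_eq_zero, norm_iteratedFDeriv_zero, norm_eq_zero]

theorem vanishesToOrder_one (hf : ContDiffAt ℝ ∞ f 0) (h0 : f 0 = 0) : VanishesToOrder f 1 :=
  .of_fderiv (eventually_differentiableAt hf (by simp)) h0
    (vanishesToOrder_zero (contDiffAt_fderiv hf).continuousAt)

end VanishingOrder

section OrderOnDiscs

variable {F : Type*} [NormedAddCommGroup F] [NormedSpace ℝ F] {f : ℂ → F} {N : ℕ}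

theorem vanishesToOrder_of_iteratedFDeriv_eq_zero (N : ℕ) :
    ∀ {F : Type*} [NormedAddCommGroup F] [NormedSpace ℝ F] {f : ℂ → F},
      ContDiffAt ℝ ∞ f 0 → (∀ k < N, iteratedFDeriv ℝ k f 0 = 0) → VanishesToOrder f N := by
  induction N with
  | zero => exact fun hf _ => vanishesToOrder_zero hf.continuousAt
  | succ N ih =>
    intro F _ _ f hf h
    exact .of_fderiv (eventually_differentiableAt hf (by simp))
      (iteratedFDeriv_zero_eq_zero_iff.1 (h 0 (by omega)))
      (ih (contDiffAt_fderiv hf) fun k hk =>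
        iteratedFDeriv_succ_eq_zero_iff.1 (h (k + 1) (by omega)))

theorem isLittleO_fderiv_of_iteratedFDeriv_eq_zero (hf : ContDiffAt ℝ ∞ f 0)
    (ho : f =o[𝓝 0] fun ζ => ‖ζ‖ ^ (N + 1)) (h : ∀ k ≤ N, iteratedFDeriv ℝ k f 0 = 0) :
    fderiv ℝ f =o[𝓝 0] fun ζ => ‖ζ‖ ^ N := by
  have hf' := contDiffAt_fderiv hf
  cases N with
  | zero =>
    simp only [zero_add, pow_one] at ho
    simpa [isLittleO_one_iff, fderiv_eq_zero_of_isLittleO ho] using hf'.continuousAt.tendsto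
  | succ N =>
    refine isLittleO_fderiv (eventually_differentiableAt hf (by simp))
      (eventually_differentiableAt hf' (by simp)) ho ?_
    exact vanishesToOrder_of_iteratedFDeriv_eq_zero N (contDiffAt_fderiv hf') fun k hk =>
      iteratedFDeriv_succ_eq_zero_iff.1 (iteratedFDeriv_succ_eq_zero_iff.1 (h (k + 2) (by omega)))

theorem iteratedFDeriv_eq_zero_of_isLittleO (N : ℕ) :
    ∀ {F : Type*} [NormedAddCommGroup F] [NormedSpace ℝ F] {f : ℂ → F},
      ContDiffAt ℝ ∞ f 0 → (f =o[𝓝 0] fun ζ => ‖ζ‖ ^ N) →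
        ∀ k ≤ N, iteratedFDeriv ℝ k f 0 = 0 := by
  induction N with
  | zero =>
    intro F _ _ f hf ho k hk
    obtain rfl : k = 0 := by omega
    rw [iteratedFDeriv_zero_eq_zero_iff]
    simp only [pow_zero, isLittleO_one_iff] at ho
    exact tendsto_nhds_unique hf.continuousAt ho
  | succ N ih =>
    intro F _ _ f hf ho
    have h1 := ih hf (ho.trans (isLittleO_norm_pow_norm_pow N.lt_succ_self))
    have h2 := ih (contDiffAt_fderiv hf) (isLittleO_fderiv_of_iteratedFDeriv_eq_zero hf ho h1)
    rintro (_ | k) hk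
    · exact h1 0 (by omega)
    · exact iteratedFDeriv_succ_eq_zero_iff.2 (h2 k (by omega))

theorem vanishesToOrder_succ_of_isLittleO (hf : ContDiffAt ℝ ∞ f 0)
    (ho : f =o[𝓝 0] fun ζ => ‖ζ‖ ^ N) : VanishesToOrder f (N + 1) :=
  vanishesToOrder_of_iteratedFDeriv_eq_zero _ hf fun k hk =>
    iteratedFDeriv_eq_zero_of_isLittleO N hf ho k (by omega)

theorem vanishesToOrder_iff_iteratedFDeriv_eq_zero (hf : ContDiffAt ℝ ∞ f 0) :
    VanishesToOrder f N ↔ ∀ k < N, iteratedFDeriv ℝ k f 0 = 0 := by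
  refine ⟨fun h k hk => ?_, vanishesToOrder_of_iteratedFDeriv_eq_zero _ hf⟩
  exact iteratedFDeriv_eq_zero_of_isLittleO k hf (h.isLittleO hk) k le_rfl

theorem le_ord₀_iff (hf : ContDiffAt ℝ ∞ f 0) : (N : ℕ∞) ≤ ord₀ f ↔ VanishesToOrder f N := by
  rw [vanishesToOrder_iff_iteratedFDeriv_eq_zero hf]
  simp only [ord₀, le_iInf_iff, Nat.cast_le]
  exact forall_congr' fun k => not_imp_comm.trans (by rw [not_le])

theorem VanishesToOrder.fderiv (hf : ContDiffAt ℝ ∞ f 0) (h : VanishesToOrder f N) :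
    VanishesToOrder (fderiv ℝ f) (N - 1) := by
  rw [vanishesToOrder_iff_iteratedFDeriv_eq_zero (contDiffAt_fderiv hf)]
  exact fun k hk => iteratedFDeriv_succ_eq_zero_iff.1
    ((vanishesToOrder_iff_iteratedFDeriv_eq_zero hf).1 h (k + 1) (by omega))

theorem VanishesToOrder.of_norm_sq (hf : ContDiffAt ℝ ∞ f 0)
    (h : VanishesToOrder (fun ζ => ‖f ζ‖ ^ 2) (2 * N - 1)) : VanishesToOrder f N := by
  cases N with
  | zero => exact vanishesToOrder_zero hf.continuousAt
  | succ N =>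
    refine vanishesToOrder_succ_of_isLittleO hf
      (IsLittleO.of_pow (n := 2) ?_ two_ne_zero).of_norm_left
    simpa [Pi.pow_def, ← pow_mul, mul_comm N 2] using h.isLittleO (show 2 * N < _ by omega)

end OrderOnDiscs

section SecondDerivative

variable {V E F : Type*} [NormedAddCommGroup V] [NormedSpace ℝ V]
  [NormedAddCommGroup E] [NormedSpace ℝ E] [NormedAddCommGroup F] [NormedSpace ℝ F]

theorem differentiableAt_fderiv {f : V → F} {z : V} (hf : ContDiffAt ℝ 2 f z) :
    DifferentiableAt ℝ (fderiv ℝ f) z :=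
  (hf.fderiv_right (m := 1) (by norm_num)).differentiableAt one_ne_zero

theorem fderiv_fderiv_apply {f : V → F} {z : V} (hf : ContDiffAt ℝ 2 f z) (t u : V) :
    fderiv ℝ (fun y => fderiv ℝ f y u) z t = fderiv ℝ (fderiv ℝ f) z t u := by
  simp [fderiv_clm_apply (differentiableAt_fderiv hf) (differentiableAt_const u)]

theorem fderiv_fderiv_comp {k : E → F} {γ : V → E} {z : V} (hk : ContDiffAt ℝ 2 k (γ z))
    (hγ : ContDiffAt ℝ 2 γ z) (t : V) :
    fderiv ℝ (fderiv ℝ fun y => k (γ y)) z t t =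
      fderiv ℝ (fderiv ℝ k) (γ z) (fderiv ℝ γ z t) (fderiv ℝ γ z t)
        + fderiv ℝ k (γ z) (fderiv ℝ (fderiv ℝ γ) z t t) := by
  have hchain : (fun y => fderiv ℝ (fun y => k (γ y)) y t) =ᶠ[𝓝 z]
      fun y => fderiv ℝ k (γ y) (fderiv ℝ γ y t) := by
    filter_upwards [eventually_differentiableAt hγ (by norm_num),
      hγ.continuousAt.eventually (eventually_differentiableAt hk (by norm_num))] with y h1 h2
    exact congrArg (· t) (fderiv_comp y h2 h1)
  have hc : ContDiffAt ℝ 2 (fun y => k (γ y)) z := hk.comp z hγ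
  have hγ' := differentiableAt_fderiv hγ
  have hk' : HasFDerivAt (fun y => fderiv ℝ k (γ y))
      ((fderiv ℝ (fderiv ℝ k) (γ z)).comp (fderiv ℝ γ z)) z :=
    (differentiableAt_fderiv hk).hasFDerivAt.comp z (hγ.differentiableAt two_ne_zero).hasFDerivAt
  rw [← fderiv_fderiv_apply hc, hchain.fderiv_eq,
    fderiv_clm_apply hk'.differentiableAt (hγ'.clm_apply (differentiableAt_const t)), hk'.fderiv]
  simp [fderiv_fderiv_apply hγ, add_comm]

end SecondDerivative

section Levi

variable {V E : Type*} [NormedAddCommGroup V] [NormedSpace ℂ V]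
  [NormedAddCommGroup E] [NormedSpace ℂ E]

/-- The `(1, 0)`-differential `∂f(z)` of a real function, so that `∂f(z) t = ∑ (∂f/∂z_j) t_j`. -/
noncomputable def del (f : V → ℝ) (z : V) : V →L[ℂ] ℂ :=
  (1 / 2 : ℂ) • StrongDual.extendRCLike (𝕜 := ℂ) (fderiv ℝ f z)

theorem del_apply (f : V → ℝ) (z t : V) :
    del f z t = 1 / 2 * (fderiv ℝ f z t - Complex.I * fderiv ℝ f z (Complex.I • t)) := by
  simp [del, StrongDual.extendRCLike_apply]

theorem norm_sq_del (f : V → ℝ) (z t : V) : ‖del f z t‖ ^ 2 =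
    (fderiv ℝ f z t ^ 2 + fderiv ℝ f z (Complex.I • t) ^ 2) / 4 := by
  rw [del_apply, ← Complex.normSq_eq_norm_sq, Complex.normSq_apply]
  simp
  ring

theorem del_eq_zero_iff {f : V → ℝ} {z t : V} : del f z t = 0 ↔ IsComplexTangent f z t := by
  rw [← norm_eq_zero, ← sq_eq_zero_iff, norm_sq_del, IsComplexTangent]
  constructor
  · intro h
    constructor <;> nlinarith [sq_nonneg (fderiv ℝ f z t),
      sq_nonneg (fderiv ℝ f z (Complex.I • t))]
  · rintro ⟨h1, h2⟩
    simp [h1, h2]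

theorem del_zero {f : V → ℝ} {z : V} (h : fderiv ℝ f z = 0) : del f z = 0 := by
  ext t
  simp [del_apply, h]

theorem del_ne_zero {f : V → ℝ} {z : V} (h : fderiv ℝ f z ≠ 0) : ∃ t, del f z t ≠ 0 := by
  by_contra! hc
  exact h (ContinuousLinearMap.ext fun t => (del_eq_zero_iff.1 (hc t)).1)

@[simp] theorem levi_zero_right (f : V → ℝ) (z : V) : levi f z 0 = 0 := by
  simp [levi]

theorem levi_smul (f : V → ℝ) (z t : V) (a : ℝ) : levi f z (a • t) = a ^ 2 * levi f z t := by
  have : Complex.I • a • t = a • Complex.I • t := smul_comm _ _ _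
  simp only [levi, this, map_smul, smul_eq_mul, smul_apply]
  ring

theorem norm_sq_del_smul (f : V → ℝ) (z t : V) (a : ℝ) :
    ‖del f z (a • t)‖ ^ 2 = a ^ 2 * ‖del f z t‖ ^ 2 := by
  have : a • t = (a : ℂ) • t := (Complex.coe_smul a t).symm
  rw [this, map_smul, norm_smul, mul_pow]
  simp

theorem levi_add {f g : V → ℝ} {z : V} (hf : ContDiffAt ℝ 2 f z) (hg : ContDiffAt ℝ 2 g z)
    (t : V) : levi (fun y => f y + g y) z t = levi f z t + levi g z t := by
  have he : fderiv ℝ (fun y => f y + g y) =ᶠ[𝓝 z] fun y => fderiv ℝ f y + fderiv ℝ g y := by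
    filter_upwards [eventually_differentiableAt hf (by norm_num),
      eventually_differentiableAt hg (by norm_num)] with y h1 h2 using fderiv_fun_add h1 h2
  rw [levi, levi, levi, he.fderiv_eq,
    fderiv_fun_add (differentiableAt_fderiv hf)
      (differentiableAt_fderiv hg)]
  simp only [add_apply]
  ring

theorem del_add {f g : V → ℝ} {z : V} (hf : DifferentiableAt ℝ f z)
    (hg : DifferentiableAt ℝ g z) (t : V) :
    del (fun y => f y + g y) z t = del f z t + del g z t := by
  rw [del_apply, del_apply, del_apply, fderiv_fun_add hf hg]
  simp only [add_apply]
  push_cast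
  ring

theorem levi_sum {ι : Type*} (s : Finset ι) {f : ι → V → ℝ} {z : V}
    (hf : ∀ i ∈ s, ContDiffAt ℝ 2 (f i) z) (t : V) :
    levi (fun y => ∑ i ∈ s, f i y) z t = ∑ i ∈ s, levi (f i) z t := by
  classical
  induction s using Finset.induction_on with
  | empty => simp [levi]
  | insert a s ha ih =>
    simp only [Finset.sum_insert ha]
    rw [levi_add (hf a (by simp)) (ContDiffAt.sum fun i hi => hf i (by simp [hi])),
      ih fun i hi => hf i (by simp [hi])]

theorem del_sum {ι : Type*} (s : Finset ι) {f : ι → V → ℝ} {z : V}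
    (hf : ∀ i ∈ s, DifferentiableAt ℝ (f i) z) (t : V) :
    del (fun y => ∑ i ∈ s, f i y) z t = ∑ i ∈ s, del (f i) z t := by
  classical
  induction s using Finset.induction_on with
  | empty => simp [del_apply]
  | insert a s ha ih =>
    simp only [Finset.sum_insert ha]
    rw [del_add (hf a (by simp)) (DifferentiableAt.fun_sum fun i hi => hf i (by simp [hi])),
      ih fun i hi => hf i (by simp [hi])]

theorem fderiv_apply_of_holomorphic {γ : V → E} {z : V} (hγ : DifferentiableAt ℂ γ z) (t : V) :
    fderiv ℝ γ z t = fderiv ℂ γ z t := by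
  rw [hγ.fderiv_restrictScalars ℝ]
  rfl

theorem fderiv_fderiv_apply_of_holomorphic {γ : V → E} {z : V} (hγ : ContDiffAt ℂ 2 γ z) (t : V) :
    fderiv ℝ (fderiv ℝ γ) z t t = fderiv ℂ (fderiv ℂ γ) z t t := by
  rw [← fderiv_fderiv_apply (hγ.restrict_scalars ℝ)]
  have he : (fun y => fderiv ℝ γ y t) =ᶠ[𝓝 z] fun y => fderiv ℂ γ y t := by
    filter_upwards [hγ.eventually (by simp)] with y hy using
      fderiv_apply_of_holomorphic (hy.differentiableAt (by norm_num)) t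
  have hd : DifferentiableAt ℂ (fderiv ℂ γ) z :=
    (hγ.fderiv_right (m := 1) (by norm_num)).differentiableAt one_ne_zero
  rw [he.fderiv_eq, fderiv_apply_of_holomorphic (hd.clm_apply (differentiableAt_const t)),
    fderiv_clm_apply hd (differentiableAt_const t)]
  simp

theorem del_comp {k : E → ℝ} {γ : V → E} {z : V} (hk : DifferentiableAt ℝ k (γ z))
    (hγ : DifferentiableAt ℂ γ z) (t : V) :
    del (fun y => k (γ y)) z t = del k (γ z) (fderiv ℂ γ z t) := by
  have h : fderiv ℝ (fun y => k (γ y)) z = (fderiv ℝ k (γ z)).comp (fderiv ℝ γ z) :=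
    fderiv_comp z hk (hγ.restrictScalars ℝ)
  rw [del_apply, del_apply, h]
  simp [fderiv_apply_of_holomorphic hγ]

theorem levi_comp {k : E → ℝ} {γ : V → E} {z : V} (hk : ContDiffAt ℝ 2 k (γ z))
    (hγ : ContDiffAt ℂ 2 γ z) (t : V) :
    levi (fun y => k (γ y)) z t = levi k (γ z) (fderiv ℂ γ z t) := by
  have hd := hγ.differentiableAt (by norm_num)
  rw [levi, fderiv_fderiv_comp hk (hγ.restrict_scalars ℝ),
    fderiv_fderiv_comp hk (hγ.restrict_scalars ℝ), fderiv_fderiv_apply_of_holomorphic hγ,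
    fderiv_fderiv_apply_of_holomorphic hγ, fderiv_apply_of_holomorphic hd,
    fderiv_apply_of_holomorphic hd, levi]
  have : fderiv ℂ (fderiv ℂ γ) z (Complex.I • t) (Complex.I • t)
      = -fderiv ℂ (fderiv ℂ γ) z t t := by
    simp only [map_smul, smul_apply, smul_smul, Complex.I_mul_I, neg_one_smul]
  rw [this, map_neg, map_smul]
  ring

theorem del_comp_clm {k : E → ℝ} (A : V →L[ℂ] E) {z : V} (hk : DifferentiableAt ℝ k (A z))
    (t : V) : del (fun y => k (A y)) z t = del k (A z) (A t) := by
  rw [del_comp hk A.differentiableAt, A.fderiv]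

theorem levi_comp_clm {k : E → ℝ} (A : V →L[ℂ] E) {z : V} (hk : ContDiffAt ℝ 2 k (A z))
    (t : V) : levi (fun y => k (A y)) z t = levi k (A z) (A t) := by
  rw [levi_comp hk A.contDiff.contDiffAt, A.fderiv]

theorem fderiv_fderiv_apply_eq_deriv_deriv {χ : ℝ → ℝ} {x : ℝ} (hχ : ContDiffAt ℝ 2 χ x) (a : ℝ) :
    fderiv ℝ (fderiv ℝ χ) x a a = deriv (deriv χ) x * a ^ 2 := by
  have hd : DifferentiableAt ℝ (deriv χ) x :=
    (differentiableAt_fderiv hχ).clm_apply (differentiableAt_const (1 : ℝ))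
  rw [← fderiv_fderiv_apply hχ]
  simp only [fderiv_eq_smul_deriv, smul_eq_mul, deriv_const_mul _ hd]
  ring

theorem levi_real_comp {χ : ℝ → ℝ} {f : V → ℝ} {z : V} (hχ : ContDiffAt ℝ 2 χ (f z))
    (hf : ContDiffAt ℝ 2 f z) (t : V) :
    levi (fun y => χ (f y)) z t =
      deriv χ (f z) * levi f z t + deriv (deriv χ) (f z) * ‖del f z t‖ ^ 2 := by
  simp only [levi, fderiv_fderiv_comp hχ hf, norm_sq_del]
  rw [fderiv_fderiv_apply_eq_deriv_deriv hχ, fderiv_fderiv_apply_eq_deriv_deriv hχ]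
  simp only [fderiv_eq_smul_deriv, smul_eq_mul]
  ring

end Levi

section Inequalities

variable {V : Type*} [NormedAddCommGroup V] [NormedSpace ℂ V]

theorem levi_neg (f : V → ℝ) (z t : V) : levi (fun y => -f y) z t = -levi f z t := by
  have : fderiv ℝ (fun y => -f y) = fun y => -fderiv ℝ f y := by
    ext1 y
    exact fderiv_fun_neg
  rw [levi, levi, this, fderiv_fun_neg]
  simp only [neg_apply]
  ring

theorem norm_sq_del_neg (f : V → ℝ) (z t : V) :
    ‖del (fun y => -f y) z t‖ ^ 2 = ‖del f z t‖ ^ 2 := by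
  rw [norm_sq_del, norm_sq_del, fderiv_fun_neg]
  simp

theorem levi_rpow {f : V → ℝ} {z : V} (hf : ContDiffAt ℝ 2 f z) (hpos : 0 < f z) (σ : ℝ) (t : V) :
    levi (fun y => f y ^ σ) z t =
      σ * f z ^ (σ - 2) * (f z * levi f z t - (1 - σ) * ‖del f z t‖ ^ 2) := by
  have hderiv : deriv (fun x : ℝ => x ^ σ) = fun x => σ * x ^ (σ - 1) :=
    funext fun x => Real.deriv_rpow_const _ _
  have hderiv₂ : deriv (fun x : ℝ => σ * x ^ (σ - 1)) (f z) = σ * ((σ - 1) * f z ^ (σ - 2)) := by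
    rw [deriv_const_mul _ (Real.differentiableAt_rpow_const_of_ne _ hpos.ne'),
      Real.deriv_rpow_const, show σ - 1 - 1 = σ - 2 by ring]
  have hpow : f z ^ (σ - 1) = f z ^ (σ - 2) * f z := by
    rw [← Real.rpow_add_one hpos.ne']
    ring_nf
  rw [levi_real_comp (Real.contDiffAt_rpow_const (Or.inl hpos.ne')) hf, hderiv, hderiv₂]
  simp only [hpow]
  ring

theorem levi_log {f : V → ℝ} {z : V} (hf : ContDiffAt ℝ 2 f z) (hpos : 0 < f z) (t : V) :
    levi (fun y => Real.log (f y)) z t =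
      (f z ^ 2)⁻¹ * (f z * levi f z t - ‖del f z t‖ ^ 2) := by
  rw [levi_real_comp (χ := Real.log) (Real.contDiffAt_log.2 hpos.ne') hf, Real.deriv_log',
    deriv_inv]
  field_simp
  ring

theorem IsDiederichFornaess.levi_gt {Ω : Set V} {ρ : V → ℝ} {s : ℝ}
    (hs : IsDiederichFornaess Ω ρ s) {z t : V} (hz : z ∈ Ω) (hρ : ContDiffAt ℝ 2 ρ z)
    (hneg : ρ z < 0) (ht : t ≠ 0) :
    -(1 - s) * ‖del ρ z t‖ ^ 2 < -ρ z * levi ρ z t := by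
  have h := hs.strictPSH.2 z hz t ht
  rw [levi_neg (fun y => (-ρ y) ^ s), levi_rpow (f := fun y => -ρ y) hρ.neg (by linarith),
    levi_neg, norm_sq_del_neg, ← mul_neg] at h
  have hp : 0 < s * (-ρ z) ^ (s - 2) := mul_pos hs.pos (Real.rpow_pos_of_pos (by linarith) _)
  have := pos_of_mul_pos_right h hp.le
  linarith

theorem IsAdmissible.pos {h : V → ℝ} (hh : IsAdmissible h) {w : V} (hw : w ≠ 0) : 0 < h w :=
  (hh.nonneg w).lt_of_ne fun h0 => hw ((hh.eq_zero_iff w).1 h0.symm)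

theorem IsAdmissible.apply_zero {h : V → ℝ} (hh : IsAdmissible h) : h 0 = 0 :=
  (hh.eq_zero_iff 0).2 rfl

theorem fderiv_eq_zero_of_nonneg {h : V → ℝ} (hn : ∀ w, 0 ≤ h w) {w : V} (hw : h w = 0) :
    fderiv ℝ h w = 0 :=
  IsLocalMin.fderiv_eq_zero (Filter.Eventually.of_forall fun v => by rw [hw]; exact hn v)

theorem PowerIsPSH.norm_sq_del_le {h : V → ℝ} (hh : IsAdmissible h) {σ : ℝ} (hσ : 0 ≤ σ)
    (hp : PowerIsPSH h σ) (w u : V) : (1 - σ) * ‖del h w u‖ ^ 2 ≤ h w * levi h w u := by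
  have hc : ContDiffAt ℝ 2 h w := (hh.smooth.of_le ENat.LEInfty.out).contDiffAt
  rcases eq_or_ne w 0 with rfl | hw
  · simp [del_zero (fderiv_eq_zero_of_nonneg hh.nonneg hh.apply_zero), hh.apply_zero]
  have hpos := hh.pos hw
  unfold PowerIsPSH at hp
  split_ifs at hp with h0
  · have := hp.2 w (by simpa using hw) u
    rw [levi_log hc hpos] at this
    have := nonneg_of_mul_nonneg_right this (by positivity)
    rw [h0]
    linarith
  · have := hp.2 w (by simpa using hw) u
    rw [levi_rpow hc hpos] at this
    have hq : 0 < σ * h w ^ (σ - 2) :=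
      mul_pos (hσ.lt_of_ne (Ne.symm h0)) (Real.rpow_pos_of_pos hpos _)
    have := nonneg_of_mul_nonneg_right this hq
    linarith

theorem norm_sq_sum_le {ι : Type*} (s : Finset ι) {d : ι → ℂ} {a l : ι → ℝ} (ha : ∀ i, 0 ≤ a i)
    (hl : ∀ i, 0 ≤ l i) (h : ∀ i, ‖d i‖ ^ 2 ≤ a i * l i) :
    ‖∑ i ∈ s, d i‖ ^ 2 ≤ (∑ i ∈ s, a i) * ∑ i ∈ s, l i := by
  refine (pow_le_pow_left₀ (norm_nonneg _) (norm_sum_le s d) 2).trans ?_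
  exact Finset.sum_sq_le_sum_mul_sum_of_sq_le_mul s (fun i _ => ha i) (fun i _ => hl i)
    fun i _ => h i

theorem levi_add_levi_pos {E F : Type*} [NormedAddCommGroup E] [NormedSpace ℂ E]
    [NormedAddCommGroup F] [NormedSpace ℂ F] {ρ : E → ℝ} {h : F → ℝ} {s σ : ℝ} (hσ : σ < s)
    {z t : E} {w u : F} (hρ : -(1 - s) * ‖del ρ z t‖ ^ 2 < -ρ z * levi ρ z t)
    (hpos : 0 < h w) (hh : (1 - σ) * ‖del h w u‖ ^ 2 ≤ h w * levi h w u) (h0 : ρ z + h w = 0)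
    (htan : del ρ z t + del h w u = 0) : 0 < levi ρ z t + levi h w u := by
  have hnorm : ‖del ρ z t‖ ^ 2 = ‖del h w u‖ ^ 2 := by
    rw [eq_neg_of_add_eq_zero_left htan, norm_neg]
  rw [neg_eq_of_add_eq_zero_right h0, hnorm] at hρ
  have hgap : 0 ≤ (s - σ) * ‖del h w u‖ ^ 2 := mul_nonneg (by linarith) (by positivity)
  have : 0 < h w * (levi ρ z t + levi h w u) := by linarith
  exact pos_of_mul_pos_right this hpos.le

end Inequalities

section NoCancellation

theorem norm_del_one_le (f : ℂ → ℝ) (ζ : ℂ) : ‖del f ζ 1‖ ≤ ‖fderiv ℝ f ζ‖ := by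
  have h1 := (fderiv ℝ f ζ).le_opNorm 1
  have hI := (fderiv ℝ f ζ).le_opNorm Complex.I
  simp only [norm_one, Complex.norm_I, mul_one] at h1 hI
  rw [del_apply, smul_eq_mul, mul_one, norm_mul]
  have := norm_sub_le (fderiv ℝ f ζ 1 : ℂ) (Complex.I * fderiv ℝ f ζ Complex.I)
  simp only [norm_mul, Complex.norm_I, Complex.norm_real, one_mul] at this
  norm_num
  linarith

theorem norm_fderiv_sq_le (f : ℂ → ℝ) (ζ : ℂ) : ‖fderiv ℝ f ζ‖ ^ 2 ≤ 8 * ‖del f ζ 1‖ ^ 2 := by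
  have hnorm : ‖fderiv ℝ f ζ‖ ≤ |fderiv ℝ f ζ 1| + |fderiv ℝ f ζ Complex.I| := by
    refine ContinuousLinearMap.opNorm_le_bound _ (by positivity) fun v => ?_
    have hv : fderiv ℝ f ζ v = v.re * fderiv ℝ f ζ 1 + v.im * fderiv ℝ f ζ Complex.I := by
      conv_lhs => rw [show v = v.re • (1 : ℂ) + v.im • Complex.I by simp]
      simp only [map_add, map_smul, smul_eq_mul]
    rw [hv, Real.norm_eq_abs, add_mul]
    refine (abs_add_le _ _).trans ?_
    rw [abs_mul, abs_mul, mul_comm |v.re|, mul_comm |v.im|]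
    gcongr
    exacts [Complex.abs_re_le_norm v, Complex.abs_im_le_norm v]
  calc ‖fderiv ℝ f ζ‖ ^ 2
      ≤ (|fderiv ℝ f ζ 1| + |fderiv ℝ f ζ Complex.I|) ^ 2 := by gcongr
    _ ≤ 2 * (|fderiv ℝ f ζ 1| ^ 2 + |fderiv ℝ f ζ Complex.I| ^ 2) := add_sq_le
    _ = 8 * ‖del f ζ 1‖ ^ 2 := by
      rw [norm_sq_del, smul_eq_mul, mul_one, sq_abs, sq_abs]
      ring

theorem abs_levi_one_le (f : ℂ → ℝ) (ζ : ℂ) : |levi f ζ 1| ≤ ‖fderiv ℝ (fderiv ℝ f) ζ‖ := by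
  have h1 := (fderiv ℝ (fderiv ℝ f) ζ).le_opNorm₂ 1 1
  have hI := (fderiv ℝ (fderiv ℝ f) ζ).le_opNorm₂ Complex.I Complex.I
  simp only [norm_one, Complex.norm_I, mul_one, Real.norm_eq_abs] at h1 hI
  rw [levi, smul_eq_mul, mul_one, abs_div, abs_of_pos (four_pos (α := ℝ))]
  linarith [abs_add_le (fderiv ℝ (fderiv ℝ f) ζ 1 1)
    (fderiv ℝ (fderiv ℝ f) ζ Complex.I Complex.I), norm_nonneg (fderiv ℝ (fderiv ℝ f) ζ)]

variable {f b : ℂ → ℝ} {M N : ℕ}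

theorem vanishesToOrder_del (hf : ContDiffAt ℝ ∞ f 0) (h : VanishesToOrder f N) :
    VanishesToOrder (fun ζ => del f ζ 1) (N - 1) :=
  (h.fderiv hf).of_norm_le 1 (.of_forall fun ζ => by simpa using norm_del_one_le f ζ)

theorem vanishesToOrder_levi (hf : ContDiffAt ℝ ∞ f 0) (h : VanishesToOrder f N) :
    VanishesToOrder (fun ζ => levi f ζ 1) (N - 2) :=
  ((h.fderiv hf).fderiv (contDiffAt_fderiv hf)).of_norm_le 1
    (.of_forall fun ζ => by simpa using abs_levi_one_le f ζ)

theorem vanishesToOrder_of_sq_mul_norm_del_sq (hb : ContDiffAt ℝ ∞ b 0) (hb0 : b 0 = 0)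
    (h : VanishesToOrder (fun ζ => b ζ ^ 2 * ‖del b ζ 1‖ ^ 2) (4 * N + 3)) :
    VanishesToOrder b (N + 2) := by
  have hsq : ContDiffAt ℝ ∞ (fun ζ => b ζ ^ 2) 0 := hb.pow 2
  have hdsq : VanishesToOrder (fderiv ℝ fun ζ => b ζ ^ 2) (2 * N + 2) := by
    refine .of_norm_sq (contDiffAt_fderiv hsq) ((h.mono (by omega)).of_norm_le 32 ?_)
    filter_upwards [eventually_differentiableAt hb (by simp)] with ζ hζ
    rw [fderiv_fun_pow 2 hζ, norm_smul]
    simp only [Nat.add_one_sub_one, pow_one, nsmul_eq_mul, Nat.cast_ofNat, mul_pow, norm_pow,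
      norm_mul, norm_norm, Real.norm_ofNat]
    linarith [mul_le_mul_of_nonneg_left (norm_fderiv_sq_le b ζ) (sq_nonneg ‖b ζ‖)]
  refine .of_norm_sq hb ?_
  simp only [Real.norm_eq_abs, sq_abs]
  exact (VanishesToOrder.of_fderiv (eventually_differentiableAt hsq (by simp)) (by simp [hb0])
    hdsq).mono (by omega)

/-- `F`, `B`, `G` stand for the norms of `∂f`, `∂b`, `∂g` and `lf`, `lb`, `lg` for the Levi forms.
Each term on the right contains `g`, `G` or `lg`. -/
theorem sq_mul_sq_le_of_levi_bounds {s σ f b g F B G lf lb lg : ℝ} (hσ0 : 0 ≤ σ)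
    (hσ : σ < s) (hs : s ≤ 1) (hb : 0 ≤ b) (hF : 0 ≤ F) (hB : 0 ≤ B) (hG : 0 ≤ G)
    (hg : f + b = g) (hl : lf + lb = lg) (hFGB : F ≤ G + B) (hbB : (1 - σ) * B ^ 2 ≤ b * lb)
    (hfF : f < 0 → -(1 - s) * F ^ 2 ≤ -f * lf) :
    b ^ 2 * B ^ 2 ≤ 4 * (g ^ 2 * B ^ 2) +
      (s - σ)⁻¹ * (2 * (b ^ 3 * |lg|) + b * |g| * B ^ 2 + b ^ 2 * (2 * (B * G) + G ^ 2)) := by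
  have hpos : 0 < s - σ := sub_pos.2 hσ
  -- If `b ≤ 2 |g|`, the first term suffices; otherwise `f < 0` and the curvature bounds combine.
  rcases le_or_gt b (2 * |g|) with hcase | hcase
  · have hsq : b ^ 2 * B ^ 2 ≤ (2 * |g|) ^ 2 * B ^ 2 := by gcongr
    rw [mul_pow, sq_abs] at hsq
    have : 0 ≤ (s - σ)⁻¹ *
      (2 * (b ^ 3 * |lg|) + b * |g| * B ^ 2 + b ^ 2 * (2 * (B * G) + G ^ 2)) := by positivity
    linarith
  have hf : f < 0 := by linarith [le_abs_self g, abs_nonneg g]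
  have hfb : -f ≤ 2 * b := by linarith [neg_abs_le g]
  have hF2 : F ^ 2 - B ^ 2 ≤ 2 * (B * G) + G ^ 2 := by
    linarith [pow_le_pow_left₀ hF hFGB 2, add_sq G B]
  have hcurv : (s - σ) * (b * B ^ 2) ≤
      b * (-f * lg) + (1 - σ) * (g * B ^ 2) + (1 - s) * (b * (F ^ 2 - B ^ 2)) := by
    rw [← hg, ← hl]
    linarith [mul_le_mul_of_nonneg_left (hfF hf) hb,
      mul_le_mul_of_nonneg_left hbB (neg_pos.2 hf).le]
  have hlg : b * (-f * lg) ≤ b * (2 * b * |lg|) := by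
    calc b * (-f * lg) ≤ b * (-f * |lg|) := by
          gcongr
          exacts [(neg_pos.2 hf).le, le_abs_self lg]
      _ ≤ b * (2 * b * |lg|) := by gcongr
  have hgB : (1 - σ) * (g * B ^ 2) ≤ |g| * B ^ 2 := by
    calc (1 - σ) * (g * B ^ 2) ≤ (1 - σ) * (|g| * B ^ 2) := by
          gcongr
          exacts [by linarith, le_abs_self g]
      _ ≤ |g| * B ^ 2 := mul_le_of_le_one_left (by positivity) (by linarith)
  have hbF : (1 - s) * (b * (F ^ 2 - B ^ 2)) ≤ b * (2 * (B * G) + G ^ 2) := by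
    calc (1 - s) * (b * (F ^ 2 - B ^ 2)) ≤ (1 - s) * (b * (2 * (B * G) + G ^ 2)) := by gcongr
      _ ≤ b * (2 * (B * G) + G ^ 2) := mul_le_of_le_one_left (by positivity) (by linarith)
  have hmain : b ^ 2 * B ^ 2 ≤ (s - σ)⁻¹ *
      (2 * (b ^ 3 * |lg|) + b * |g| * B ^ 2 + b ^ 2 * (2 * (B * G) + G ^ 2)) := by
    rw [le_inv_mul_iff₀ hpos]
    linarith [mul_le_mul_of_nonneg_left (hcurv.trans (add_le_add (add_le_add hlg hgB) hbF)) hb]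
  linarith [mul_nonneg (sq_nonneg g) (sq_nonneg B)]

theorem vanishesToOrder_succ_of_add_of_power {s σ : ℝ} (hσ0 : 0 ≤ σ) (hσ : σ < s) (hs : s ≤ 1)
    (hf : ContDiffAt ℝ ∞ f 0) (hb : ContDiffAt ℝ ∞ b 0) (hb0 : b 0 = 0)
    (hnonneg : ∀ᶠ ζ in 𝓝 0, 0 ≤ b ζ)
    (hbpow : ∀ᶠ ζ in 𝓝 0, (1 - σ) * ‖del b ζ 1‖ ^ 2 ≤ b ζ * levi b ζ 1)
    (hfpow : ∀ᶠ ζ in 𝓝 0,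
      f ζ < 0 → -(1 - s) * ‖del f ζ 1‖ ^ 2 ≤ -f ζ * levi f ζ 1)
    (hbN : VanishesToOrder b (N + 1)) (hg : VanishesToOrder (fun ζ => f ζ + b ζ) (N + 2)) :
    VanishesToOrder b (N + 2) := by
  have hgs : ContDiffAt ℝ ∞ (fun ζ => f ζ + b ζ) 0 := hf.add hb
  have hadd : ∀ᶠ ζ in 𝓝 0, levi (fun ζ => f ζ + b ζ) ζ 1 = levi f ζ 1 + levi b ζ 1 ∧
      del (fun ζ => f ζ + b ζ) ζ 1 = del f ζ 1 + del b ζ 1 := by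
    filter_upwards [eventually_contDiffAt_two hf, eventually_contDiffAt_two hb] with ζ hfζ hbζ
    exact ⟨levi_add hfζ hbζ 1,
      del_add (hfζ.differentiableAt two_ne_zero) (hbζ.differentiableAt two_ne_zero) 1⟩
  have hB : VanishesToOrder (fun ζ => ‖del b ζ 1‖) N := (vanishesToOrder_del hb hbN).norm
  have hG : VanishesToOrder (fun ζ => ‖del (fun ζ => f ζ + b ζ) ζ 1‖) (N + 1) :=
    (vanishesToOrder_del hgs hg).norm
  have hlg : VanishesToOrder (fun ζ => ‖levi (fun ζ => f ζ + b ζ) ζ 1‖) N :=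
    (vanishesToOrder_levi hgs hg).norm
  have hbound := ((((hg.pow 2).mul (hB.pow 2)).mono (N := 4 * N + 3) (by omega)).const_mul 4).add
    ((((((hbN.pow 3).mul hlg).mono (N := 4 * N + 3) (by omega)).const_mul 2).add
      (((hbN.mul hg.norm).mul (hB.pow 2)).mono (by omega))).add
      (((hbN.pow 2).mul (((hB.mul hG).const_mul 2).add ((hG.pow 2).mono (N := N + (N + 1))
        (by omega)))).mono (by omega)) |>.const_mul (s - σ)⁻¹)
  refine vanishesToOrder_of_sq_mul_norm_del_sq hb hb0 (hbound.of_norm_le 1 ?_)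
  filter_upwards [hadd, hnonneg, hbpow, hfpow] with ζ ⟨hlevi, hdel⟩ hb0 hbp hfp
  have hFGB : ‖del f ζ 1‖ ≤ ‖del (fun ζ => f ζ + b ζ) ζ 1‖ + ‖del b ζ 1‖ := by
    simpa [hdel] using norm_sub_le (del f ζ 1 + del b ζ 1) (del b ζ 1)
  rw [one_mul, Real.norm_of_nonneg (by positivity)]
  exact (sq_mul_sq_le_of_levi_bounds hσ0 hσ hs hb0 (norm_nonneg _) (norm_nonneg _)
    (norm_nonneg _) rfl hlevi.symm hFGB hbp hfp).trans (le_abs_self _)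

theorem vanishesToOrder_of_add_of_power {s σ : ℝ} (hσ0 : 0 ≤ σ) (hσ : σ < s) (hs : s ≤ 1)
    (hf : ContDiffAt ℝ ∞ f 0) (hb : ContDiffAt ℝ ∞ b 0) (hb0 : b 0 = 0)
    (hnonneg : ∀ᶠ ζ in 𝓝 0, 0 ≤ b ζ)
    (hbpow : ∀ᶠ ζ in 𝓝 0, (1 - σ) * ‖del b ζ 1‖ ^ 2 ≤ b ζ * levi b ζ 1)
    (hfpow : ∀ᶠ ζ in 𝓝 0, f ζ < 0 → -(1 - s) * ‖del f ζ 1‖ ^ 2 ≤ -f ζ * levi f ζ 1)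
    (hg : VanishesToOrder (fun ζ => f ζ + b ζ) M) : VanishesToOrder b M := by
  suffices H : ∀ N ≤ M, VanishesToOrder b N from H M le_rfl
  intro N
  induction N with
  | zero => exact fun _ => vanishesToOrder_zero hb.continuousAt
  | succ N ih =>
    intro hN
    rcases N with _ | N
    · exact vanishesToOrder_one hb hb0
    · exact vanishesToOrder_succ_of_add_of_power hσ0 hσ hs hf hb hb0 hnonneg hbpow hfpow
        (ih (by omega)) (hg.mono hN)

theorem vanishesToOrder_of_norm_fderiv_sq_le {E : Type*} [NormedAddCommGroup E] [NormedSpace ℂ E]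
    {γ : ℂ → E} {A c : ℝ} (hf : ContDiffAt ℝ ∞ f 0) (hγ : ContDiffAt ℂ ∞ γ 0) (hγ0 : γ 0 = 0)
    (hc : 0 < c)
    (hstrict : ∀ᶠ ζ in 𝓝 0, c * ‖fderiv ℂ γ ζ 1‖ ^ 2 ≤ levi f ζ 1 + A * ‖del f ζ 1‖ ^ 2)
    (hfM : VanishesToOrder f M) (hN : 2 * N ≤ M + 1) : VanishesToOrder γ N := by
  have hγr : ContDiffAt ℝ ∞ γ 0 := hγ.restrict_scalars ℝ
  cases N with
  | zero => exact vanishesToOrder_zero hγ.continuousAt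
  | succ N =>
    refine .of_fderiv (eventually_differentiableAt hγr (by simp)) hγ0
      (.of_norm_sq (contDiffAt_fderiv hγr) ?_)
    have hbound := ((vanishesToOrder_levi hf hfM).mono (N := 2 * N - 1) (by omega)).add
      ((((vanishesToOrder_del hf hfM).norm.pow 2).mono (by omega)).const_mul A)
    refine hbound.of_norm_le c⁻¹ ?_
    filter_upwards [hstrict, eventually_differentiableAt hγ (by simp)] with ζ hζ hγζ
    rw [Real.norm_of_nonneg (by positivity), le_inv_mul_iff₀ hc]
    rw [fderiv_apply_one_eq_deriv, norm_deriv_eq_norm_fderiv] at hζ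
    rw [hγζ.fderiv_restrictScalars ℝ, ContinuousLinearMap.norm_restrictScalars]
    exact hζ.trans (le_abs_self _)

end NoCancellation

section Coercivity

variable {V : Type*} [NormedAddCommGroup V] [NormedSpace ℂ V] {r : V → ℝ} {q : V}

theorem continuousAt_levi (hr : ContDiffAt ℝ ∞ r q) (t : V) :
    ContinuousAt (fun x : V × V => levi r x.1 x.2) (q, t) := by
  have hD : ContinuousAt (fun x : V × V => fderiv ℝ (fderiv ℝ r) x.1) (q, t) :=
    ContinuousAt.comp (contDiffAt_fderiv (contDiffAt_fderiv hr)).continuousAt continuousAt_fst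
  have ht : ContinuousAt (fun x : V × V => x.2) (q, t) := continuousAt_snd
  have hI : ContinuousAt (fun x : V × V => Complex.I • x.2) (q, t) := ht.const_smul Complex.I
  exact (((hD.clm_apply ht).clm_apply ht).add ((hD.clm_apply hI).clm_apply hI)).div_const 4

theorem continuousAt_del (hr : ContDiffAt ℝ ∞ r q) (t : V) :
    ContinuousAt (fun x : V × V => del r x.1 x.2) (q, t) := by
  have hD : ContinuousAt (fun x : V × V => fderiv ℝ r x.1) (q, t) :=
    ContinuousAt.comp (contDiffAt_fderiv hr).continuousAt continuousAt_fst
  have ht : ContinuousAt (fun x : V × V => x.2) (q, t) := continuousAt_snd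
  have hI : ContinuousAt (fun x : V × V => Complex.I • x.2) (q, t) := ht.const_smul Complex.I
  have hre := Complex.continuous_ofReal.continuousAt.comp (hD.clm_apply ht)
  have him := Complex.continuous_ofReal.continuousAt.comp (hD.clm_apply hI)
  simp only [del_apply]
  exact continuousAt_const.mul (hre.sub (continuousAt_const.mul him))

theorem exists_levi_add_mul_pos {t : V} (hpos : del r q t = 0 → 0 < levi r q t) :
    ∃ A : ℝ, 0 < levi r q t + A * ‖del r q t‖ ^ 2 := by
  by_cases h0 : del r q t = 0
  · exact ⟨0, by simpa using hpos h0⟩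
  · have hdel : 0 < ‖del r q t‖ ^ 2 := by positivity
    refine ⟨(1 - levi r q t) / ‖del r q t‖ ^ 2, ?_⟩
    rw [div_mul_cancel₀ _ hdel.ne']
    linarith

theorem exists_levi_add_mul_ge_of_isCompact {K : Set V} (hK : IsCompact K)
    (hr : ContDiffAt ℝ ∞ r q) (hpos : ∀ t ∈ K, del r q t = 0 → 0 < levi r q t) :
    ∃ A c : ℝ, 0 < c ∧ ∀ᶠ z in 𝓝 q, ∀ t ∈ K, c ≤ levi r z t + A * ‖del r z t‖ ^ 2 := by
  refine hK.induction_on (p := fun S => ∃ A c : ℝ, 0 < c ∧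
    ∀ᶠ z in 𝓝 q, ∀ t ∈ S, c ≤ levi r z t + A * ‖del r z t‖ ^ 2) ?_ ?_ ?_ ?_
  · exact ⟨0, 1, one_pos, by simp⟩
  · rintro S T hST ⟨A, c, hc, h⟩
    exact ⟨A, c, hc, h.mono fun z hz t ht => hz t (hST ht)⟩
  · rintro S T ⟨A, c, hc, h⟩ ⟨A', c', hc', h'⟩
    refine ⟨max A A', min c c', lt_min hc hc', ?_⟩
    filter_upwards [h, h'] with z hz hz' t ht
    rcases ht with ht | ht
    · exact (min_le_left c c').trans ((hz t ht).trans (by gcongr; exact le_max_left A A'))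
    · exact (min_le_right c c').trans ((hz' t ht).trans (by gcongr; exact le_max_right A A'))
  · intro t ht
    obtain ⟨A, hA⟩ := exists_levi_add_mul_pos (hpos t ht)
    have hcont : ContinuousAt (fun x : V × V => levi r x.1 x.2 + A * ‖del r x.1 x.2‖ ^ 2) (q, t) :=
      (continuousAt_levi hr t).add (((continuousAt_del hr t).norm.pow 2).const_mul A)
    obtain ⟨p, hp, p', hp', hpp'⟩ :=
      eventually_prod_iff.1 (nhds_prod_eq (x := q) (y := t) ▸
        hcont.eventually_const_lt (half_lt_self hA))
    exact ⟨{u | p' u}, mem_nhdsWithin_of_mem_nhds hp', A, _, half_pos hA,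
      hp.mono fun z hz u hu => (hpp' hz hu).le⟩

theorem exists_levi_add_mul_ge [ProperSpace V] (hr : ContDiffAt ℝ ∞ r q)
    (hpos : ∀ t ≠ 0, del r q t = 0 → 0 < levi r q t) :
    ∃ A c : ℝ, 0 < c ∧ ∀ᶠ z in 𝓝 q, ∀ t, c * ‖t‖ ^ 2 ≤ levi r z t + A * ‖del r z t‖ ^ 2 := by
  obtain ⟨A, c, hc, h⟩ := exists_levi_add_mul_ge_of_isCompact (isCompact_sphere (0 : V) 1) hr
    fun t ht => hpos t (ne_zero_of_mem_unit_sphere ⟨t, ht⟩)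
  refine ⟨A, c, hc, h.mono fun z hz t => ?_⟩
  rcases eq_or_ne t 0 with rfl | ht
  · simp
  have hn : 0 < ‖t‖ := norm_pos_iff.2 ht
  have hunit := hz (‖t‖⁻¹ • t) (by simp [norm_smul, hn.ne'])
  rw [levi_smul, norm_sq_del_smul] at hunit
  calc c * ‖t‖ ^ 2
      ≤ (‖t‖⁻¹ ^ 2 * levi r z t + A * (‖t‖⁻¹ ^ 2 * ‖del r z t‖ ^ 2)) * ‖t‖ ^ 2 := by gcongr
    _ = levi r z t + A * ‖del r z t‖ ^ 2 := by field_simp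

end Coercivity

section DefiningFunctions

theorem exists_tendsto_eq_zero_isBigO_sub {𝕜 E F : Type*} [NontriviallyNormedField 𝕜]
    [NormedAddCommGroup E] [NormedSpace 𝕜 E] [CompleteSpace E] [NormedAddCommGroup F]
    [NormedSpace 𝕜 F] [CompleteSpace F] {f : E → F} {f' : E →L[𝕜] F} {p : E}
    (hf : HasStrictFDerivAt f f' p) (h0 : f p = 0) (hsurj : f'.range = ⊤) :
    ∃ y : E → E, Tendsto y (𝓝 p) (𝓝 p) ∧ (∀ᶠ x in 𝓝 p, f (y x) = 0) ∧
      (fun x => x - y x) =O[𝓝 p] f := by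
  set g := f'.nonlinearRightInverseOfSurjective hsurj
  have hK : 0 < (g.nnnorm : ℝ) := f'.nonlinearRightInverseOfSurjective_nnnorm_pos hsurj
  obtain ⟨S, hS, happrox⟩ := hf.approximates_deriv_on_nhds (c := g.nnnorm⁻¹ / 2)
    (.inr (div_pos (inv_pos.2 hK) two_pos))
  obtain ⟨δ, hδ, hδS⟩ := Metric.mem_nhds_iff.1 hS
  have hsmall : ∀ᶠ x in 𝓝 p, dist x p + 2 * g.nnnorm * ‖f x‖ < δ := by
    have hcont : ContinuousAt (fun x => dist x p + 2 * g.nnnorm * ‖f x‖) p := by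
      have := hf.continuousAt
      fun_prop
    exact hcont.tendsto.eventually_lt_const (by simpa [h0] using hδ)
  have hsolve : ∀ x, dist x p + 2 * g.nnnorm * ‖f x‖ < δ →
      ∃ y, f y = 0 ∧ ‖x - y‖ ≤ 2 * g.nnnorm * ‖f x‖ := by
    intro x hx
    have hball : Metric.closedBall x (2 * g.nnnorm * ‖f x‖) ⊆ S :=
      (Metric.closedBall_subset_ball' (by linarith)).trans hδS
    have hzero : (0 : F) ∈ Metric.closedBall (f x)
        (((g.nnnorm : ℝ)⁻¹ - (g.nnnorm⁻¹ / 2 : NNReal)) * (2 * g.nnnorm * ‖f x‖)) := by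
      rw [mem_closedBall_iff_norm', sub_zero]
      refine le_of_eq ?_
      push_cast
      field_simp
      ring
    obtain ⟨y, hy, hfy⟩ := happrox.surjOn_closedBall_of_nonlinearRightInverse g (by positivity)
      hball hzero
    exact ⟨y, hfy, mem_closedBall_iff_norm'.1 hy⟩
  choose! y hy using hsolve
  have hO : (fun x => x - y x) =O[𝓝 p] f := .of_bound _ (hsmall.mono fun x hx => (hy x hx).2)
  refine ⟨y, ?_, hsmall.mono fun x hx => (hy x hx).1, hO⟩
  have hf0 : Tendsto f (𝓝 p) (𝓝 0) := h0 ▸ hf.continuousAt.tendsto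
  simpa using tendsto_id.sub (hO.trans_tendsto hf0)

variable {V : Type*} [NormedAddCommGroup V] [NormedSpace ℂ V] {Ω U : Set V} {p z : V}
  {ρ r r₁ r₂ : V → ℝ}

theorem IsLocalDefiningFunction.contDiffAt (h : IsLocalDefiningFunction Ω p r) :
    ContDiffAt ℝ ∞ r p := by
  obtain ⟨W, hW, hp, hc, -⟩ := h
  exact hc.contDiffAt (hW.mem_nhds hp)

theorem IsLocalDefiningFunction.eventually_eq_zero_of_eq_zero
    (h₁ : IsLocalDefiningFunction Ω p r₁) (h₂ : IsLocalDefiningFunction Ω p r₂) :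
    ∀ᶠ y in 𝓝 p, r₂ y = 0 → r₁ y = 0 := by
  obtain ⟨W₁, hW₁, hp₁, hr₁, hΩ₁, -⟩ := h₁
  have hd : ∀ᶠ y in 𝓝 p, fderiv ℝ r₂ y ≠ 0 := by
    obtain ⟨W₂, -, -, -, -, -, hd₂⟩ := id h₂
    exact (contDiffAt_fderiv h₂.contDiffAt).continuousAt.eventually_ne hd₂
  obtain ⟨W₂, hW₂, hp₂, -, hΩ₂, -⟩ := h₂
  filter_upwards [hd, hW₁.mem_nhds hp₁, hW₂.mem_nhds hp₂] with y hdy hy₁ hy₂ hy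
  refine le_antisymm ?_ (not_lt.1 fun hlt => ((hΩ₂ y hy₂).1 ((hΩ₁ y hy₁).2 hlt)).ne hy)
  by_contra! hpos
  -- Otherwise `Ω` misses a neighbourhood of `y`, and `y` is a minimum of `r₂`.
  refine hdy (IsLocalMin.fderiv_eq_zero ?_)
  filter_upwards [(hr₁.contDiffAt (hW₁.mem_nhds hy₁)).continuousAt.eventually_const_lt hpos,
    hW₁.mem_nhds hy₁, hW₂.mem_nhds hy₂] with x hx hx₁ hx₂
  rw [hy]
  exact not_lt.1 fun hlt => hx.not_gt ((hΩ₁ x hx₁).1 ((hΩ₂ x hx₂).2 hlt))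

theorem IsLocalDefiningFunction.isBigO [CompleteSpace V] (h₁ : IsLocalDefiningFunction Ω p r₁)
    (h₂ : IsLocalDefiningFunction Ω p r₂) : r₁ =O[𝓝 p] r₂ := by
  have hs₁ := h₁.contDiffAt.hasStrictFDerivAt (by simp)
  have hs₂ := h₂.contDiffAt.hasStrictFDerivAt (by simp)
  obtain ⟨-, -, -, -, -, h0₂, hd₂⟩ := id h₂
  obtain ⟨y, hy, hy0, hO⟩ := exists_tendsto_eq_zero_isBigO_sub hs₂ h0₂
    (LinearMap.range_eq_top.2 (LinearMap.surjective fun h => hd₂ (by ext v; exact congr($h v))))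
  have hlip : (fun x => r₁ x - r₁ (y x)) =O[𝓝 p] fun x => x - y x :=
    hs₁.isBigO_sub.comp_tendsto (tendsto_id.prodMk_nhds hy)
  refine (hlip.trans hO).congr' ?_ .rfl
  filter_upwards [hy.eventually (h₁.eventually_eq_zero_of_eq_zero h₂), hy0] with x hx hx0
  rw [hx hx0, sub_zero]

theorem IsDefiningFunction.contDiffAt (hρ : IsDefiningFunction Ω U ρ) (hz : z ∈ U) :
    ContDiffAt ℝ ∞ ρ z :=
  hρ.smooth.contDiffAt (hρ.isOpen.mem_nhds hz)

theorem IsDefiningFunction.mem_iff (hρ : IsDefiningFunction Ω U ρ) (hz : z ∈ U) :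
    z ∈ Ω ↔ ρ z < 0 := by
  have hmem : z ∈ Ω ↔ z ∈ {z ∈ U | ρ z < 0} := by rw [← hρ.eq]
  exact hmem.trans (and_iff_right hz)

theorem IsDefiningFunction.neg (hρ : IsDefiningFunction Ω U ρ) (hz : z ∈ Ω) : ρ z < 0 :=
  (hρ.mem_iff (hρ.closure_subset (subset_closure hz))).1 hz

theorem IsDefiningFunction.isLocalDefiningFunction (hρ : IsDefiningFunction Ω U ρ)
    (hz : z ∈ frontier Ω) : IsLocalDefiningFunction Ω z ρ := by
  have hzU : z ∈ U := hρ.closure_subset hz.1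
  have hcont : ContinuousAt ρ z := (hρ.contDiffAt hzU).continuousAt
  have : (𝓝[Ω] z).NeBot := mem_closure_iff_nhdsWithin_neBot.1 hz.1
  refine ⟨U, hρ.isOpen, hzU, hρ.smooth, fun x hx => hρ.mem_iff hx, le_antisymm ?_ ?_,
    hρ.gradient z hz⟩
  · exact le_of_tendsto hcont.continuousWithinAt (eventually_mem_nhdsWithin.mono fun x hx =>
      (hρ.neg hx).le)
  · refine not_lt.1 fun hlt => hz.2 (mem_interior_iff_mem_nhds.2 ?_)
    filter_upwards [hcont.eventually_lt_const hlt, hρ.isOpen.mem_nhds hzU] with x hx hxU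
    exact (hρ.mem_iff hxU).2 hx

theorem IsDiederichFornaess.levi_nonneg_of_mem_closure {s : ℝ} (hs : IsDiederichFornaess Ω ρ s)
    (hneg : ∀ z ∈ Ω, ρ z < 0) (hz : z ∈ closure Ω) (hρ : ContDiffAt ℝ ∞ ρ z)
    (hd : fderiv ℝ ρ z ≠ 0) {t : V} (ht : del ρ z t = 0) : 0 ≤ levi ρ z t := by
  obtain ⟨e, he⟩ := del_ne_zero hd
  have hdel : ∀ t, ContinuousAt (fun y => del ρ y t) z := fun t =>
    ContinuousAt.comp (g := fun x : V × V => del ρ x.1 x.2) (f := fun y => (y, t))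
      (continuousAt_del hρ t) (by fun_prop)
  -- Correct `t` at nearby points `y ∈ Ω` to a complex tangent vector of the level set of `ρ`.
  obtain ⟨τ, hτy⟩ : ∃ τ : V → V, ∀ y, τ y = t - (del ρ y t / del ρ y e) • e := ⟨_, fun _ => rfl⟩
  have hτ : Tendsto τ (𝓝 z) (𝓝 t) := by
    have hquot := ((hdel t).div₀ (hdel e) he).tendsto.smul_const e
    have hlim := (tendsto_const_nhds (x := t)).sub hquot
    simpa only [← hτy, ht, zero_div, zero_smul, sub_zero] using hlim
  have hlevi : Tendsto (fun y => levi ρ y (τ y)) (𝓝 z) (𝓝 (levi ρ z t)) :=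
    Tendsto.comp (g := fun x : V × V => levi ρ x.1 x.2) (f := fun y => (y, τ y))
      (continuousAt_levi hρ t) (tendsto_id.prodMk_nhds hτ)
  have : (𝓝[Ω] z).NeBot := mem_closure_iff_nhdsWithin_neBot.1 hz
  refine ge_of_tendsto (hlevi.mono_left (nhdsWithin_le_nhds (s := Ω))) ?_
  filter_upwards [self_mem_nhdsWithin, nhdsWithin_le_nhds ((hdel e).eventually_ne he),
    nhdsWithin_le_nhds (eventually_contDiffAt_two hρ)] with y hy hye hyc
  have htangent : del ρ y (τ y) = 0 := by
    simp only [hτy, map_sub, map_smul, smul_eq_mul, div_mul_cancel₀ _ hye, sub_self]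
  rcases eq_or_ne (τ y) 0 with h0 | h0
  · rw [h0, levi_zero_right]
  · have hgt := hs.levi_gt hy hyc (hneg y hy) h0
    rw [htangent, norm_zero, zero_pow two_ne_zero, mul_zero] at hgt
    exact (pos_of_mul_pos_right hgt (neg_nonneg.2 (hneg y hy).le)).le

end DefiningFunctions

section Types

variable {V W : Type*} [NormedAddCommGroup V] [NormedSpace ℂ V]
  [NormedAddCommGroup W] [NormedSpace ℂ W] {φ : ℂ → V} {k l : V → ℝ} {z : V} {M ν : ℕ}

/-- A holomorphic map of the unit disc into `V` with `φ(0) = 0`. Unlike for `IsDisc`, the zero map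
is allowed, so that the class is stable under composition with linear maps. -/
def IsDisc₀ (φ : ℂ → V) : Prop :=
  DifferentiableOn ℂ φ (Metric.ball 0 1) ∧ φ 0 = 0

theorem IsDisc.isDisc₀ (h : IsDisc φ) : IsDisc₀ φ := ⟨h.1, h.2.1⟩

theorem IsDisc₀.comp_clm (h : IsDisc₀ φ) (A : V →L[ℂ] W) : IsDisc₀ fun ζ => A (φ ζ) :=
  ⟨A.differentiable.comp_differentiableOn h.1, by simp [h.2]⟩

theorem IsDisc₀.isDisc_of_not_vanishesToOrder (h : IsDisc₀ φ) (hν : ¬ VanishesToOrder φ ν) :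
    IsDisc φ := by
  refine ⟨h.1, h.2, ?_⟩
  by_contra! hzero
  refine hν ((isBigO_zero _ _).congr' ?_ .rfl)
  filter_upwards [Metric.ball_mem_nhds (0 : ℂ) one_pos] with ζ hζ
  exact (hzero ζ hζ).symm

theorem not_vanishesToOrder_smul_const {v : V} (hv : v ≠ 0) :
    ¬ VanishesToOrder (fun ζ : ℂ => ζ • v) 2 := by
  intro h
  have hid : (fun ζ : ℂ => ‖ζ‖) =O[𝓝 0] fun ζ => ζ • v :=
    .of_bound ‖v‖⁻¹ (.of_forall fun ζ => by
      rw [norm_smul, norm_norm, mul_comm ‖ζ‖, inv_mul_cancel_left₀ (norm_ne_zero_iff.2 hv)])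
  have hlittle : (fun ζ : ℂ => ‖ζ‖) =o[𝓝 0] fun ζ => ‖ζ‖ := by
    simpa only [pow_one] using hid.trans_isLittleO (h.isLittleO one_lt_two)
  have hne : ∃ᶠ ζ : ℂ in 𝓝 0, ‖ζ‖ ≠ 0 := by
    simpa only [norm_ne_zero_iff, mem_compl_singleton_iff] using
      (eventually_mem_nhdsWithin (a := (0 : ℂ)) (s := {0}ᶜ)).frequently.filter_mono
        nhdsWithin_le_nhds
  exact isLittleO_irrefl hne hlittle

theorem toENNReal_le_of_forall_natCast_le {x : ℕ∞} {y : ℝ≥0∞}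
    (h : ∀ M : ℕ, (M : ℕ∞) ≤ x → (M : ℝ≥0∞) ≤ y) : (x : ℝ≥0∞) ≤ y := by
  induction x using ENat.recTopCoe with
  | top => simpa [ENNReal.iSup_natCast] using iSup_le fun M => h M le_top
  | coe M => simpa using h M le_rfl

variable [CompleteSpace V]

theorem IsDisc₀.contDiffAt (h : IsDisc₀ φ) : ContDiffAt ℂ ∞ φ 0 :=
  (h.1.analyticAt (Metric.ball_mem_nhds 0 one_pos)).contDiffAt

theorem IsDisc₀.contDiffAt_real (h : IsDisc₀ φ) : ContDiffAt ℝ ∞ φ 0 :=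
  h.contDiffAt.restrict_scalars ℝ

theorem IsDisc₀.contDiffAt_comp (h : IsDisc₀ φ) (hk : ContDiffAt ℝ ∞ k z) :
    ContDiffAt ℝ ∞ (fun ζ => k (z + φ ζ)) 0 :=
  ContDiffAt.comp (𝕜 := ℝ) (g := k) (f := fun ζ => z + φ ζ) 0 (by simpa [h.2] using hk)
    (contDiffAt_const.add h.contDiffAt_real)

theorem IsDisc₀.tendsto (h : IsDisc₀ φ) (z : V) : Tendsto (fun ζ => z + φ ζ) (𝓝 0) (𝓝 z) := by
  simpa [h.2] using h.contDiffAt.continuousAt.tendsto.const_add z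

theorem IsDisc₀.eventually_levi_comp (hφ : IsDisc₀ φ) (hk : ContDiffAt ℝ ∞ k z) :
    ∀ᶠ ζ in 𝓝 0, levi (fun ζ => k (z + φ ζ)) ζ 1 = levi k (z + φ ζ) (fderiv ℂ φ ζ 1) := by
  filter_upwards [(hφ.contDiffAt.of_le (m := 2) ENat.LEInfty.out).eventually (by simp),
    (hφ.tendsto z).eventually (eventually_contDiffAt_two hk)] with ζ hφζ hkζ
  rw [levi_comp (γ := fun ζ => z + φ ζ) hkζ (contDiffAt_const.add hφζ), fderiv_const_add]

theorem IsDisc₀.eventually_del_comp (hφ : IsDisc₀ φ) (hk : ContDiffAt ℝ ∞ k z) :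
    ∀ᶠ ζ in 𝓝 0, del (fun ζ => k (z + φ ζ)) ζ 1 = del k (z + φ ζ) (fderiv ℂ φ ζ 1) := by
  filter_upwards [eventually_differentiableAt hφ.contDiffAt (by simp),
    (hφ.tendsto z).eventually (eventually_differentiableAt hk (by simp))] with ζ hφζ hkζ
  rw [del_comp (γ := fun ζ => z + φ ζ) hkζ (hφζ.const_add z), fderiv_const_add]

theorem one_le_ord₀ (hφ : IsDisc₀ φ) : 1 ≤ ord₀ φ := by
  exact_mod_cast (le_ord₀_iff hφ.contDiffAt_real).2 (vanishesToOrder_one hφ.contDiffAt_real hφ.2)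

theorem natCast_le_typ_mul (hk : ContDiffAt ℝ ∞ k z) (hφ : IsDisc₀ φ)
    (hM : VanishesToOrder (fun ζ => k (z + φ ζ)) M) (hν : ¬ VanishesToOrder φ (ν + 1)) :
    (M : ℝ≥0∞) ≤ typ k z * ν := by
  have hord : ord₀ φ ≤ ν := by
    rw [← not_lt, ← ENat.add_one_le_iff (by simp)]
    exact_mod_cast fun h => hν ((le_ord₀_iff hφ.contDiffAt_real).1 h)
  have hord' : (ord₀ φ : ℝ≥0∞) ≤ ν := by exact_mod_cast ENat.toENNReal_le.2 hord
  have hpos : (ord₀ φ : ℝ≥0∞) ≠ 0 := by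
    simpa using (one_pos.trans_le (one_le_ord₀ hφ)).ne'
  have htyp : (ord₀ (fun ζ => k (z + φ ζ)) : ℝ≥0∞) / (ord₀ φ : ℝ≥0∞) ≤ typ k z :=
    le_iSup₂_of_le φ (hφ.isDisc_of_not_vanishesToOrder hν) le_rfl
  calc (M : ℝ≥0∞) ≤ (ord₀ (fun ζ => k (z + φ ζ)) : ℝ≥0∞) := by
        exact_mod_cast ENat.toENNReal_le.2 ((le_ord₀_iff (hφ.contDiffAt_comp hk)).2 hM)
    _ ≤ typ k z * (ord₀ φ : ℝ≥0∞) :=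
        (ENNReal.div_le_iff hpos (hord'.trans_lt (by simp)).ne).1 htyp
    _ ≤ typ k z * ν := by gcongr

theorem typ_le_of_forall_natCast_le_mul {T : ℝ≥0∞} (hk : ContDiffAt ℝ ∞ k z)
    (h : ∀ φ : ℂ → V, IsDisc₀ φ → ∀ M ν : ℕ, VanishesToOrder (fun ζ => k (z + φ ζ)) M →
      ¬ VanishesToOrder φ (ν + 1) → (M : ℝ≥0∞) ≤ T * ν) : typ k z ≤ T := by
  refine iSup₂_le fun φ hφ => ?_
  rcases eq_or_ne (ord₀ φ) ⊤ with htop | htop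
  · simp [htop]
  obtain ⟨ν, hν⟩ := ENat.ne_top_iff_exists.1 htop
  refine ENNReal.div_le_of_le_mul (toENNReal_le_of_forall_natCast_le fun M hM => ?_)
  rw [← hν, ENat.toENNReal_coe]
  refine h φ hφ.isDisc₀ M ν ((le_ord₀_iff (hφ.isDisc₀.contDiffAt_comp hk)).1 hM) fun hO => ?_
  have hle := (le_ord₀_iff hφ.isDisc₀.contDiffAt_real).2 hO
  rw [← hν, Nat.cast_le] at hle
  omega

theorem typ_le_typ_of_isBigO (hk : ContDiffAt ℝ ∞ k z) (hl : ContDiffAt ℝ ∞ l z)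
    (h : l =O[𝓝 z] k) : typ k z ≤ typ l z :=
  typ_le_of_forall_natCast_le_mul hk fun _ hφ _ _ hM hν =>
    natCast_le_typ_mul hl hφ ((h.comp_tendsto (hφ.tendsto z)).trans hM) hν

theorem IsLocalDefiningFunction.typ_eq {Ω : Set V} (hk : IsLocalDefiningFunction Ω z k)
    (hl : IsLocalDefiningFunction Ω z l) : typ k z = typ l z :=
  le_antisymm (typ_le_typ_of_isBigO hk.contDiffAt hl.contDiffAt (hl.isBigO hk))
    (typ_le_typ_of_isBigO hl.contDiffAt hk.contDiffAt (hk.isBigO hl))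

theorem typ_le_typ_of_linearIsometry [CompleteSpace W] (A : V →ₗᵢ[ℂ] W) {l : W → ℝ} {w : W}
    (hk : ContDiffAt ℝ ∞ k z) (hl : ContDiffAt ℝ ∞ l w) (h : ∀ v, l (w + A v) = k (z + v)) :
    typ k z ≤ typ l w := by
  refine typ_le_of_forall_natCast_le_mul hk fun φ hφ M ν hM hν =>
    natCast_le_typ_mul hl (hφ.comp_clm A.toContinuousLinearMap) (by simpa [h] using hM)
      fun hA => hν (hA.of_norm_le 1 (by simp))

theorem two_le_typ [Nontrivial V] (hk : ContDiffAt ℝ ∞ k z) (h0 : k z = 0)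
    (hD : fderiv ℝ k z = 0) : 2 ≤ typ k z := by
  obtain ⟨v, hv⟩ := exists_ne (0 : V)
  have hφ : IsDisc₀ fun ζ : ℂ => ζ • v := ⟨by fun_prop, by simp⟩
  have hkφ := hφ.contDiffAt_comp hk
  have hDφ : fderiv ℝ (fun ζ : ℂ => k (z + ζ • v)) 0 = 0 := by
    have hkz : DifferentiableAt ℝ k (z + (0 : ℂ) • v) := by
      simpa using hk.differentiableAt (by simp)
    rw [fderiv_fun_comp (f := fun ζ : ℂ => z + ζ • v) 0 hkz (by fun_prop)]
    simp [hD]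
  have hM : VanishesToOrder (fun ζ : ℂ => k (z + ζ • v)) 2 :=
    .of_fderiv (eventually_differentiableAt hkφ (by simp)) (by simpa using h0)
      (vanishesToOrder_one (contDiffAt_fderiv hkφ) hDφ)
  simpa using natCast_le_typ_mul hk hφ hM (not_vanishesToOrder_smul_const hv)

end Types

section Product

variable {E F : Type*} [NormedAddCommGroup E] [NormedSpace ℂ E] [NormedAddCommGroup F]
  [NormedSpace ℂ F]

/-- The function `ρ(z) + h(w)`, which defines the Hartogs domain `tilde U ρ h`. -/
def prodFun (ρ : E → ℝ) (h : F → ℝ) (x : E × F) : ℝ := ρ x.1 + h x.2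

variable {ρ : E → ℝ} {h : F → ℝ} {q : E × F}

theorem contDiffAt_prodFun {n : ℕ∞ω} (hρ : ContDiffAt ℝ n ρ q.1) (hh : ContDiffAt ℝ n h q.2) :
    ContDiffAt ℝ n (prodFun ρ h) q :=
  hρ.fst''.add hh.snd''

theorem levi_prodFun (hρ : ContDiffAt ℝ 2 ρ q.1) (hh : ContDiffAt ℝ 2 h q.2) (t : E × F) :
    levi (prodFun ρ h) q t = levi ρ q.1 t.1 + levi h q.2 t.2 :=
  (levi_add hρ.fst'' hh.snd'' t).trans
    (congr_arg₂ _ (levi_comp_clm (.fst ℂ E F) hρ t) (levi_comp_clm (.snd ℂ E F) hh t))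

theorem del_prodFun (hρ : DifferentiableAt ℝ ρ q.1) (hh : DifferentiableAt ℝ h q.2) (t : E × F) :
    del (prodFun ρ h) q t = del ρ q.1 t.1 + del h q.2 t.2 :=
  (del_add (f := fun x : E × F => ρ x.1) (g := fun x : E × F => h x.2)
    (by fun_prop) (by fun_prop) t).trans
    (congr_arg₂ _ (del_comp_clm (.fst ℂ E F) hρ t) (del_comp_clm (.snd ℂ E F) hh t))

theorem fderiv_prodFun_ne_zero (hρ : DifferentiableAt ℝ ρ q.1) (hh : DifferentiableAt ℝ h q.2)
    (hd : fderiv ℝ ρ q.1 ≠ 0 ∨ fderiv ℝ h q.2 ≠ 0) : fderiv ℝ (prodFun ρ h) q ≠ 0 := by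
  intro h0
  have hdel : ∀ t : E × F, 0 = del ρ q.1 t.1 + del h q.2 t.2 := fun t => by
    rw [← del_prodFun hρ hh, del_zero h0, zero_apply]
  rcases hd with hd | hd
  · obtain ⟨t, ht⟩ := del_ne_zero hd
    exact ht (by simpa using (hdel (t, 0)).symm)
  · obtain ⟨t, ht⟩ := del_ne_zero hd
    exact ht (by simpa using (hdel (0, t)).symm)

theorem levi_prodFun_of_fst_eq_zero (hρ : ContDiffAt ℝ 2 ρ q.1) (hh : ContDiffAt ℝ 2 h q.2)
    {t : E × F} (ht : t.1 = 0) : levi (prodFun ρ h) q t = levi h q.2 t.2 := by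
  rw [levi_prodFun hρ hh, ht, levi_zero_right, zero_add]

theorem levi_prodFun_pos_of_fst_ne_zero {s σ : ℝ} (hσ : σ < s) (hρc : ContDiffAt ℝ 2 ρ q.1)
    (hρ : ∀ t ≠ 0, -(1 - s) * ‖del ρ q.1 t‖ ^ 2 < -ρ q.1 * levi ρ q.1 t)
    (hhc : ContDiffAt ℝ 2 h q.2) (hpos : 0 < h q.2)
    (hpow : ∀ u, (1 - σ) * ‖del h q.2 u‖ ^ 2 ≤ h q.2 * levi h q.2 u) (h0 : ρ q.1 + h q.2 = 0)
    {t : E × F} (ht : t.1 ≠ 0) (htan : del (prodFun ρ h) q t = 0) :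
    0 < levi (prodFun ρ h) q t := by
  rw [del_prodFun (hρc.differentiableAt two_ne_zero) (hhc.differentiableAt two_ne_zero)] at htan
  rw [levi_prodFun hρc hhc]
  exact levi_add_levi_pos hσ (hρ _ ht) hpos (hpow _) h0 htan

theorem levi_prodFun_pos {s σ : ℝ} (hσ : σ < s) (hρc : ContDiffAt ℝ 2 ρ q.1)
    (hρ : ∀ t ≠ 0, -(1 - s) * ‖del ρ q.1 t‖ ^ 2 < -ρ q.1 * levi ρ q.1 t)
    (hhc : ContDiffAt ℝ 2 h q.2) (hpos : 0 < h q.2)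
    (hpow : ∀ u, (1 - σ) * ‖del h q.2 u‖ ^ 2 ≤ h q.2 * levi h q.2 u)
    (hstrict : ∀ u ≠ 0, 0 < levi h q.2 u) (h0 : ρ q.1 + h q.2 = 0) {t : E × F} (ht : t ≠ 0)
    (htan : del (prodFun ρ h) q t = 0) : 0 < levi (prodFun ρ h) q t := by
  rcases eq_or_ne t.1 0 with ht₁ | ht₁
  · rw [levi_prodFun_of_fst_eq_zero hρc hhc ht₁]
    exact hstrict _ fun ht₂ => ht (Prod.ext ht₁ ht₂)
  · exact levi_prodFun_pos_of_fst_ne_zero hσ hρc hρ hhc hpos hpow h0 ht₁ htan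

end Product

section HartogsDomain

variable {E : Type*} [NormedAddCommGroup E] [NormedSpace ℂ E] {Ω U : Set E} {ρ : E → ℝ} {s σ : ℝ}

theorem IsDiederichFornaess.levi_gt_of_neg (hs : IsDiederichFornaess Ω ρ s)
    (hρ : IsDefiningFunction Ω U ρ) {z : E} (hz : z ∈ U) (hneg : ρ z < 0) {t : E} (ht : t ≠ 0) :
    -(1 - s) * ‖del ρ z t‖ ^ 2 < -ρ z * levi ρ z t :=
  hs.levi_gt ((hρ.mem_iff hz).2 hneg) ((hρ.contDiffAt hz).of_le ENat.LEInfty.out) hneg ht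

theorem mem_closure_of_mem_frontier_tilde {F : Type*} [TopologicalSpace F] {h : F → ℝ} {q : E × F}
    (hρ : IsDefiningFunction Ω U ρ) (hh : Continuous h) (hn : ∀ w, 0 ≤ h w)
    (hq : q ∈ frontier (tilde U ρ h)) :
    q.1 ∈ closure Ω ∧ ρ q.1 + h q.2 = 0 := by
  have hsub : tilde U ρ h ⊆ Prod.fst ⁻¹' Ω := fun x hx =>
    (hρ.mem_iff hx.1).2 (by linarith [hn x.2, hx.2])
  have hcl : q.1 ∈ closure Ω := continuous_fst.closure_preimage_subset _ (closure_mono hsub hq.1)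
  have hU : q.1 ∈ U := hρ.closure_subset hcl
  have hc : ContinuousAt (prodFun ρ h) q :=
    ((hρ.contDiffAt hU).continuousAt.comp continuousAt_fst).add
      (hh.continuousAt.comp continuousAt_snd)
  refine ⟨hcl, le_antisymm ?_ (not_lt.1 fun hlt => hq.2 (mem_interior_iff_mem_nhds.2 ?_))⟩
  · have := mem_closure_iff_nhdsWithin_neBot.1 hq.1
    exact le_of_tendsto hc.continuousWithinAt
      (eventually_mem_nhdsWithin.mono fun _ (hx : _ ∈ tilde U ρ h) => hx.2.le)
  · filter_upwards [(hρ.isOpen.preimage continuous_fst).mem_nhds hU,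
      hc.eventually_lt_const hlt] with x hxU hx using ⟨hxU, hx⟩

variable {F : Type*} [NormedAddCommGroup F] [NormedSpace ℂ F] {h : F → ℝ} {q : E × F}

theorem isLocalDefiningFunction_tilde (hρ : IsDefiningFunction Ω U ρ) (hh : ContDiff ℝ ∞ h)
    (hq : q.1 ∈ U) (h0 : ρ q.1 + h q.2 = 0) (hd : fderiv ℝ ρ q.1 ≠ 0 ∨ fderiv ℝ h q.2 ≠ 0) :
    IsLocalDefiningFunction (tilde U ρ h) q (prodFun ρ h) :=
  ⟨Prod.fst ⁻¹' U, hρ.isOpen.preimage continuous_fst, hq,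
    fun _ hx => (contDiffAt_prodFun (hρ.contDiffAt hx) hh.contDiffAt).contDiffWithinAt,
    fun _ hx => and_iff_right hx, h0,
    fderiv_prodFun_ne_zero ((hρ.contDiffAt hq).differentiableAt (by simp))
      (hh.contDiffAt.differentiableAt (by simp)) hd⟩

theorem isStrictPseudoconvexAt_tilde (hρ : IsDefiningFunction Ω U ρ)
    (hs : IsDiederichFornaess Ω ρ s) (hh : ContDiff ℝ ∞ h) (hn : ∀ w, 0 ≤ h w) (hσ : σ < s)
    (hq : q ∈ frontier (tilde U ρ h)) (hpos : 0 < h q.2) (hgrad : fderiv ℝ h q.2 ≠ 0)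
    (hpow : ∀ u, (1 - σ) * ‖del h q.2 u‖ ^ 2 ≤ h q.2 * levi h q.2 u)
    (hstrict : ∀ u ≠ 0, 0 < levi h q.2 u) : IsStrictPseudoconvexAt (tilde U ρ h) q := by
  obtain ⟨hcl, h0⟩ := mem_closure_of_mem_frontier_tilde hρ hh.continuous hn hq
  have hU := hρ.closure_subset hcl
  exact ⟨_, isLocalDefiningFunction_tilde hρ hh hU h0 (.inr hgrad), fun t ht hne =>
    levi_prodFun_pos hσ ((hρ.contDiffAt hU).of_le ENat.LEInfty.out)
      (fun _ => hs.levi_gt_of_neg hρ hU (by linarith)) (hh.contDiffAt.of_le ENat.LEInfty.out) hpos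
      hpow hstrict h0 hne (del_eq_zero_iff.2 ht)⟩

theorem isPseudoconvex_tilde (hρ : IsDefiningFunction Ω U ρ) (hs : IsDiederichFornaess Ω ρ s)
    (hh : ContDiff ℝ ∞ h) (hn : ∀ w, 0 ≤ h w) (hσ : σ < s)
    (hgrad : ∀ w, 0 < h w → fderiv ℝ h w ≠ 0)
    (hpow : ∀ w u, (1 - σ) * ‖del h w u‖ ^ 2 ≤ h w * levi h w u)
    (hpsh : ∀ w u, 0 ≤ levi h w u) : IsPseudoconvex (tilde U ρ h) := by
  intro q hq
  obtain ⟨hcl, h0⟩ := mem_closure_of_mem_frontier_tilde hρ hh.continuous hn hq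
  have hU := hρ.closure_subset hcl
  have hρc : ContDiffAt ℝ 2 ρ q.1 := (hρ.contDiffAt hU).of_le ENat.LEInfty.out
  have hhc : ContDiffAt ℝ 2 h q.2 := hh.contDiffAt.of_le ENat.LEInfty.out
  rcases (hn q.2).eq_or_lt with hzero | hpos
  · have hfr : q.1 ∈ frontier Ω := ⟨hcl, fun hi => by linarith [hρ.neg (interior_subset hi)]⟩
    have hd := hρ.gradient _ hfr
    refine ⟨_, isLocalDefiningFunction_tilde hρ hh hU h0 (.inl hd), fun t ht => ?_⟩
    rw [← del_eq_zero_iff, del_prodFun (hρc.differentiableAt two_ne_zero)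
      (hhc.differentiableAt two_ne_zero), del_zero (fderiv_eq_zero_of_nonneg hn hzero.symm),
      zero_apply, add_zero] at ht
    rw [levi_prodFun hρc hhc]
    exact add_nonneg (hs.levi_nonneg_of_mem_closure (fun _ => hρ.neg) hcl (hρ.contDiffAt hU) hd ht)
      (hpsh _ _)
  · refine ⟨_, isLocalDefiningFunction_tilde hρ hh hU h0 (.inr (hgrad _ hpos)), fun t ht => ?_⟩
    rcases eq_or_ne t.1 0 with ht₁ | ht₁
    · exact (levi_prodFun_of_fst_eq_zero hρc hhc ht₁).symm ▸ hpsh _ _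
    · exact (levi_prodFun_pos_of_fst_ne_zero hσ hρc
        (fun _ => hs.levi_gt_of_neg hρ hU (by linarith)) hhc hpos (hpow _) h0 ht₁
        (del_eq_zero_iff.2 ht)).le

end HartogsDomain

section ProductType

variable {E F : Type*} [NormedAddCommGroup E] [NormedSpace ℂ E] [NormedAddCommGroup F]
  [NormedSpace ℂ F] {f : E → ℝ} {b : F → ℝ} {p : E} {w : F} {s σ : ℝ}

theorem vanishesToOrder_snd_of_prodFun [CompleteSpace E] [CompleteSpace F] (hσ0 : 0 ≤ σ)
    (hσ : σ < s) (hs : s ≤ 1) (hf : ContDiffAt ℝ ∞ f p) (hb : ContDiffAt ℝ ∞ b w) (hb0 : b w = 0)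
    (hnonneg : ∀ᶠ y in 𝓝 w, 0 ≤ b y)
    (hbpow : ∀ᶠ y in 𝓝 w, ∀ u, (1 - σ) * ‖del b y u‖ ^ 2 ≤ b y * levi b y u)
    (hfpow : ∀ᶠ z in 𝓝 p, f z < 0 → ∀ t, -(1 - s) * ‖del f z t‖ ^ 2 ≤ -f z * levi f z t)
    {φ : ℂ → E} {ψ : ℂ → F} (hφ : IsDisc₀ φ) (hψ : IsDisc₀ ψ) {M : ℕ}
    (hM : VanishesToOrder (fun ζ => f (p + φ ζ) + b (w + ψ ζ)) M) :
    VanishesToOrder (fun ζ => b (w + ψ ζ)) M := by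
  refine vanishesToOrder_of_add_of_power hσ0 hσ hs (hφ.contDiffAt_comp hf)
    (hψ.contDiffAt_comp hb) (by simpa [hψ.2] using hb0) ((hψ.tendsto w).eventually hnonneg)
    ?_ ?_ hM
  · filter_upwards [hψ.eventually_levi_comp hb, hψ.eventually_del_comp hb,
      (hψ.tendsto w).eventually hbpow] with ζ hlevi hdel hpow
    rw [hlevi, hdel]
    exact hpow _
  · filter_upwards [hφ.eventually_levi_comp hf, hφ.eventually_del_comp hf,
      (hφ.tendsto p).eventually hfpow] with ζ hlevi hdel hpow hneg
    rw [hlevi, hdel]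
    exact hpow hneg _

theorem typ_prodFun [CompleteSpace E] [CompleteSpace F] (hσ0 : 0 ≤ σ) (hσ : σ < s) (hs : s ≤ 1)
    (hf : ContDiffAt ℝ ∞ f p) (hf0 : f p = 0) (hb : ContDiffAt ℝ ∞ b w) (hb0 : b w = 0)
    (hnonneg : ∀ᶠ y in 𝓝 w, 0 ≤ b y)
    (hbpow : ∀ᶠ y in 𝓝 w, ∀ u, (1 - σ) * ‖del b y u‖ ^ 2 ≤ b y * levi b y u)
    (hfpow : ∀ᶠ z in 𝓝 p, f z < 0 → ∀ t, -(1 - s) * ‖del f z t‖ ^ 2 ≤ -f z * levi f z t) :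
    typ (prodFun f b) (p, w) = max (typ f p) (typ b w) := by
  have hfb : ContDiffAt ℝ ∞ (prodFun f b) (p, w) := contDiffAt_prodFun hf hb
  refine le_antisymm (typ_le_of_forall_natCast_le_mul hfb fun γ hγ M ν hM hν => ?_) (max_le ?_ ?_)
  · have hφ : IsDisc₀ fun ζ => (γ ζ).1 := hγ.comp_clm (.fst ℂ E F)
    have hψ : IsDisc₀ fun ζ => (γ ζ).2 := hγ.comp_clm (.snd ℂ E F)
    have hbM := vanishesToOrder_snd_of_prodFun hσ0 hσ hs hf hb hb0 hnonneg hbpow hfpow hφ hψ hM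
    have hfM : VanishesToOrder (fun ζ => f (p + (γ ζ).1)) M := by
      simpa [VanishesToOrder, prodFun] using IsBigO.sub hM hbM
    by_cases hφν : VanishesToOrder (fun ζ => (γ ζ).1) (ν + 1)
    · refine (natCast_le_typ_mul hb hψ hbM fun hψν => hν (hφν.prod_left hψν)).trans ?_
      gcongr
      exact le_max_right _ _
    · refine (natCast_le_typ_mul hf hφ hfM hφν).trans ?_
      gcongr
      exact le_max_left _ _
  · exact typ_le_typ_of_linearIsometry (.inl ℂ E F) hf hfb fun v => by simp [prodFun, hb0]
  · exact typ_le_typ_of_linearIsometry (.inr ℂ E F) hb hfb fun v => by simp [prodFun, hf0]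

theorem typ_le_two_of_strict [ProperSpace E] (hf : ContDiffAt ℝ ∞ f p)
    (hstrict : ∀ t ≠ 0, del f p t = 0 → 0 < levi f p t) : typ f p ≤ 2 := by
  obtain ⟨A, c, hc, hest⟩ := exists_levi_add_mul_ge hf hstrict
  refine typ_le_of_forall_natCast_le_mul hf fun φ hφ M ν hM hν => ?_
  suffices hle : M ≤ 2 * ν by exact_mod_cast hle
  by_contra! hlt
  refine hν (vanishesToOrder_of_norm_fderiv_sq_le (hφ.contDiffAt_comp hf) hφ.contDiffAt hφ.2 hc
    (A := A) ?_ hM (by omega))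
  filter_upwards [hφ.eventually_levi_comp hf, hφ.eventually_del_comp hf,
    (hφ.tendsto p).eventually hest] with ζ hlevi hdel hζ
  rw [hlevi, hdel]
  exact hζ _

theorem eventually_neg_half_mul_le_of_strict [ProperSpace E] (hf : ContDiffAt ℝ ∞ f p)
    (hf0 : f p = 0) (hstrict : ∀ t ≠ 0, del f p t = 0 → 0 < levi f p t) :
    ∀ᶠ z in 𝓝 p, f z < 0 → ∀ t, -(1 - 1 / 2) * ‖del f z t‖ ^ 2 ≤ -f z * levi f z t := by
  obtain ⟨A, c, hc, hest⟩ := exists_levi_add_mul_ge hf hstrict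
  have hsmall : ∀ᶠ z in 𝓝 p, -f z * A < 1 / 2 :=
    (hf.continuousAt.neg.mul continuousAt_const).eventually_lt_const (by simp [hf0])
  filter_upwards [hest, hsmall] with z hz hsmallz hneg t
  have hlevi : 0 ≤ levi f z t + A * ‖del f z t‖ ^ 2 := le_trans (by positivity) (hz t)
  have hgap : -f z * A * ‖del f z t‖ ^ 2 ≤ 1 / 2 * ‖del f z t‖ ^ 2 := by gcongr
  linarith [mul_nonneg (neg_nonneg.2 hneg.le) hlevi]

theorem typ_prodFun_of_strict [ProperSpace E] [CompleteSpace F] [Nontrivial F]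
    (hf : ContDiffAt ℝ ∞ f p) (hf0 : f p = 0)
    (hstrict : ∀ t ≠ 0, del f p t = 0 → 0 < levi f p t) (hb : ContDiffAt ℝ ∞ b w) (hb0 : b w = 0)
    (hnonneg : ∀ y, 0 ≤ b y) (hlog : ∀ y u, ‖del b y u‖ ^ 2 ≤ b y * levi b y u) :
    typ (prodFun f b) (p, w) = typ b w := by
  rw [typ_prodFun le_rfl one_half_pos one_half_lt_one.le hf hf0 hb hb0 (.of_forall hnonneg)
    (.of_forall fun y u => by simpa using hlog y u)
    (eventually_neg_half_mul_le_of_strict hf hf0 hstrict)]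
  exact max_eq_right ((typ_le_two_of_strict hf hstrict).trans
    (two_le_typ hb hb0 (fderiv_eq_zero_of_nonneg hnonneg hb0)))

end ProductType

section Sums

variable {ι : Type*} [Fintype ι] {F : ι → Type*} [∀ i, NormedAddCommGroup (F i)]
  [∀ i, NormedSpace ℂ (F i)] {h : ∀ i, F i → ℝ} {w : ∀ i, F i}

/-- The separated sum `∑ h_i(w_i)`, that is, `sumFun` for arbitrary factors. -/
def sepSum {ι : Type*} [Fintype ι] {F : ι → Type*} (h : ∀ i, F i → ℝ) (w : ∀ i, F i) : ℝ :=
  ∑ i, h i (w i)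

theorem sepSum_nonneg {F : ι → Type*} {h : ∀ i, F i → ℝ} (hn : ∀ i w, 0 ≤ h i w) (w : ∀ i, F i) :
    0 ≤ sepSum h w :=
  Finset.sum_nonneg fun i _ => hn i (w i)

theorem sepSum_eq_zero {F : ι → Type*} {h : ∀ i, F i → ℝ} {w : ∀ i, F i}
    (hw : ∀ i, h i (w i) = 0) : sepSum h w = 0 :=
  Finset.sum_eq_zero fun i _ => hw i

theorem VanishesToOrder.of_sepSum {X : Type*} [NormedAddCommGroup X] {F : ι → Type*}
    {h : ∀ i, F i → ℝ} {g : ∀ i, X → F i} {N : ℕ} (hn : ∀ i w, 0 ≤ h i w)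
    (hN : VanishesToOrder (fun x => sepSum h fun i => g i x) N) (i : ι) :
    VanishesToOrder (fun x => h i (g i x)) N := by
  refine hN.of_norm_le 1 (.of_forall fun x => ?_)
  rw [one_mul, Real.norm_of_nonneg (hn _ _), Real.norm_of_nonneg (sepSum_nonneg hn _)]
  exact Finset.single_le_sum (f := fun i => h i (g i x)) (fun i _ => hn i _) (Finset.mem_univ i)

theorem contDiff_sepSum {n : ℕ∞ω} (hh : ∀ i, ContDiff ℝ n (h i)) : ContDiff ℝ n (sepSum h) :=
  ContDiff.sum fun i _ => (hh i).comp (ContinuousLinearMap.proj (R := ℝ) (φ := F) i).contDiff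

theorem levi_sepSum (hh : ∀ i, ContDiffAt ℝ 2 (h i) (w i)) (u : ∀ i, F i) :
    levi (sepSum h) w u = ∑ i, levi (h i) (w i) (u i) :=
  (levi_sum Finset.univ (fun i _ => (hh i).comp w
    (ContinuousLinearMap.proj (R := ℝ) (φ := F) i).contDiff.contDiffAt) u).trans
    (Finset.sum_congr rfl fun i _ =>
      levi_comp_clm (.proj (R := ℂ) (φ := F) i) (hh i) u)

theorem del_sepSum (hh : ∀ i, DifferentiableAt ℝ (h i) (w i)) (u : ∀ i, F i) :
    del (sepSum h) w u = ∑ i, del (h i) (w i) (u i) :=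
  (del_sum Finset.univ (fun i _ => (hh i).comp w (differentiableAt_apply i w)) u).trans
    (Finset.sum_congr rfl fun i _ =>
      del_comp_clm (.proj (R := ℂ) (φ := F) i) (hh i) u)

theorem norm_sq_del_sepSum_le (hh : ∀ i, ContDiffAt ℝ 2 (h i) (w i)) (hn : ∀ i, 0 ≤ h i (w i))
    {u : ∀ i, F i} (hlevi : ∀ i, 0 ≤ levi (h i) (w i) (u i))
    (hlog : ∀ i, ‖del (h i) (w i) (u i)‖ ^ 2 ≤ h i (w i) * levi (h i) (w i) (u i)) :
    ‖del (sepSum h) w u‖ ^ 2 ≤ sepSum h w * levi (sepSum h) w u := by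
  rw [levi_sepSum hh, del_sepSum fun i => (hh i).differentiableAt two_ne_zero]
  exact norm_sq_sum_le _ hn hlevi hlog

theorem levi_sepSum_pos (hh : ∀ i, ContDiffAt ℝ 2 (h i) (w i))
    (hstrict : ∀ i, ∀ u ≠ 0, 0 < levi (h i) (w i) u) {u : ∀ i, F i} (hu : u ≠ 0) :
    0 < levi (sepSum h) w u := by
  have hlevi : ∀ i u, 0 ≤ levi (h i) (w i) u := fun i u => by
    rcases eq_or_ne u 0 with rfl | hu
    · exact (levi_zero_right _ _).ge
    · exact (hstrict i u hu).le
  rw [levi_sepSum hh]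
  obtain ⟨i, hi⟩ := Function.ne_iff.1 hu
  exact Finset.sum_pos' (fun i _ => hlevi i _) ⟨i, Finset.mem_univ _, hstrict i _ hi⟩

theorem fderiv_sepSum_ne_zero (hh : ∀ i, DifferentiableAt ℝ (h i) (w i)) {i : ι}
    (hi : fderiv ℝ (h i) (w i) ≠ 0) : fderiv ℝ (sepSum h) w ≠ 0 := by
  classical
  intro h0
  obtain ⟨t, ht⟩ := del_ne_zero hi
  have hdel := del_sepSum hh (Pi.single i t)
  rw [del_zero h0, Finset.sum_eq_single i (fun j _ hj => by simp [hj]) (by simp)] at hdel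
  exact ht (by simpa using hdel.symm)

theorem typ_sepSum [∀ i, CompleteSpace (F i)] (hh : ∀ i, ContDiff ℝ ∞ (h i))
    (hn : ∀ i w, 0 ≤ h i w) (hw : ∀ i, h i (w i) = 0) :
    typ (sepSum h) w = ⨆ i, typ (h i) (w i) := by
  classical
  have hc : ContDiffAt ℝ ∞ (sepSum h) w := (contDiff_sepSum hh).contDiffAt
  refine le_antisymm (typ_le_of_forall_natCast_le_mul hc fun γ hγ M ν hM hν => ?_)
    (iSup_le fun i => typ_le_typ_of_linearIsometry (.single ℂ F i) (hh i).contDiffAt hc fun v => ?_)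
  · obtain ⟨i, hi⟩ : ∃ i, ¬ VanishesToOrder (fun ζ => γ ζ i) (ν + 1) := by
      by_contra! hall
      exact hν (isBigO_pi.2 hall)
    calc (M : ℝ≥0∞) ≤ typ (h i) (w i) * ν :=
          natCast_le_typ_mul (hh i).contDiffAt (hγ.comp_clm (.proj (R := ℂ) (φ := F) i))
            (VanishesToOrder.of_sepSum hn hM i) hi
      _ ≤ (⨆ i, typ (h i) (w i)) * ν := by gcongr; exact le_iSup (fun i => typ (h i) (w i)) i
  · have hv : LinearIsometry.single ℂ F i v = Pi.single i v := rfl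
    rw [hv]
    exact (Finset.sum_eq_single i (fun j _ hj => by simp [hj, hw]) (by simp)).trans (by simp)

end Sums

section Splitting

theorem norm_eq_max_restrict {ι : Type*} [Fintype ι] {F : ι → Type*} [∀ i, NormedAddCommGroup (F i)]
    (P : ι → Prop) [DecidablePred P] (w : ∀ i, F i) :
    ‖w‖ = max ‖fun j : {i // ¬ P i} => w j‖ ‖fun j : {i // P i} => w j‖ := by
  refine le_antisymm ((pi_norm_le_iff_of_nonneg (by positivity)).2 fun i => ?_)
    (max_le ((pi_norm_le_iff_of_nonneg (norm_nonneg w)).2 fun j => norm_le_pi_norm w j)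
      ((pi_norm_le_iff_of_nonneg (norm_nonneg w)).2 fun j => norm_le_pi_norm w j))
  by_cases hi : P i
  · exact le_max_of_le_right (norm_le_pi_norm (fun j : {i // P i} => w j) ⟨i, hi⟩)
  · exact le_max_of_le_left (norm_le_pi_norm (fun j : {i // ¬ P i} => w j) ⟨i, hi⟩)

variable (E : Type*) [NormedAddCommGroup E] [NormedSpace ℂ E] {ι : Type*} [Fintype ι]
  (F : ι → Type*) [∀ i, NormedAddCommGroup (F i)] [∀ i, NormedSpace ℂ (F i)]

/-- The isometry that moves the coordinates `w_i` without the property `P` to the first factor `E`,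
for reading `ρ(z) + ∑ h_i(w_i)` as a function of the remaining coordinates added to a function of
all others. -/
def splitCoords (P : ι → Prop) [DecidablePred P] :
    (E × ∀ i, F i) ≃ₗᵢ[ℂ] (E × ∀ j : {i // ¬ P i}, F j) × ∀ j : {i // P i}, F j where
  toFun x := ((x.1, fun j => x.2 j), fun j => x.2 j)
  invFun y := (y.1.1, fun i => if hi : P i then y.2 ⟨i, hi⟩ else y.1.2 ⟨i, hi⟩)
  map_add' _ _ := rfl
  map_smul' _ _ := rfl
  left_inv x := by ext <;> simp
  right_inv y := by
    refine Prod.ext (Prod.ext rfl (funext fun j => ?_)) (funext fun j => ?_)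
    · simp [j.2]
    · simp [j.2]
  norm_map' x := by
    rw [Prod.norm_def x, norm_eq_max_restrict P x.2, ← max_assoc]
    rfl

variable {E F}

theorem prodFun_sepSum_eq_splitCoords (P : ι → Prop) [DecidablePred P] (ρ : E → ℝ)
    (h : ∀ i, F i → ℝ) (x : E × ∀ i, F i) :
    prodFun ρ (sepSum h) x =
      prodFun (prodFun ρ (sepSum fun j : {i // ¬ P i} => h j)) (sepSum fun j : {i // P i} => h j)
        (splitCoords E F P x) := by
  change ρ x.1 + ∑ i, h i (x.2 i) =
    ρ x.1 + ∑ j : {i // ¬ P i}, h j (x.2 j) + ∑ j : {i // P i}, h j (x.2 j)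
  rw [← Fintype.sum_subtype_add_sum_subtype P]
  ring

theorem typ_comp_linearIsometryEquiv {V W : Type*} [NormedAddCommGroup V] [NormedSpace ℂ V]
    [CompleteSpace V] [NormedAddCommGroup W] [NormedSpace ℂ W] [CompleteSpace W] (A : V ≃ₗᵢ[ℂ] W)
    {k : W → ℝ} {z : V} (hk : ContDiffAt ℝ ∞ k (A z)) : typ (fun x => k (A x)) z = typ k (A z) := by
  have hkA : ContDiffAt ℝ ∞ (fun x => k (A x)) z :=
    hk.comp z (A.toContinuousLinearEquiv.contDiff.restrict_scalars ℝ).contDiffAt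
  exact le_antisymm (typ_le_typ_of_linearIsometry A.toLinearIsometry hkA hk fun v => by simp)
    (typ_le_typ_of_linearIsometry A.symm.toLinearIsometry hk hkA fun v => by simp)

theorem typ_prodFun_sepSum_eq_typ_splitCoords [CompleteSpace E] [∀ i, CompleteSpace (F i)]
    (P : ι → Prop) [DecidablePred P] {ρ : E → ℝ} {h : ∀ i, F i → ℝ} {q : E × ∀ i, F i}
    (hρ : ContDiffAt ℝ ∞ ρ q.1) (hh : ∀ i, ContDiff ℝ ∞ (h i)) :
    typ (prodFun ρ (sepSum h)) q =
      typ (prodFun (prodFun ρ (sepSum fun j : {i // ¬ P i} => h j))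
        (sepSum fun j : {i // P i} => h j)) (splitCoords E F P q) := by
  rw [funext (prodFun_sepSum_eq_splitCoords P ρ h)]
  exact typ_comp_linearIsometryEquiv (splitCoords E F P) (contDiffAt_prodFun
    (contDiffAt_prodFun hρ (ContDiff.contDiffAt (contDiff_sepSum fun j => hh j)))
    (ContDiff.contDiffAt (contDiff_sepSum fun j => hh j)))

end Splitting

section ConditionII

/-- What Condition II asks of a single summand `h_i`, except that its type be finite. -/
structure IsConditionIISummand {V : Type*} [NormedAddCommGroup V] [NormedSpace ℂ V] (h : V → ℝ) :
    Prop where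
  admissible : IsAdmissible h
  psh : IsPSHOn h univ
  log_psh : IsPSHOn (fun w => Real.log (h w)) {0}ᶜ
  strictPSH : IsStrictPSHOn h {0}ᶜ

namespace IsConditionIISummand

variable {V : Type*} [NormedAddCommGroup V] [NormedSpace ℂ V] {h : V → ℝ}

theorem contDiffAt (hh : IsConditionIISummand h) {n : ℕ∞} (w : V) : ContDiffAt ℝ n h w :=
  (hh.admissible.smooth.of_le (mod_cast le_top)).contDiffAt

theorem levi_nonneg (hh : IsConditionIISummand h) (w u : V) : 0 ≤ levi h w u :=
  hh.psh.2 w (mem_univ w) u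

theorem norm_sq_del_le (hh : IsConditionIISummand h) (w u : V) :
    ‖del h w u‖ ^ 2 ≤ h w * levi h w u := by
  have hlog : PowerIsPSH h 0 := (if_pos rfl).mpr hh.log_psh
  simpa using hlog.norm_sq_del_le hh.admissible le_rfl w u

end IsConditionIISummand

variable {ι : Type*} [Fintype ι] {F : ι → Type*} [∀ i, NormedAddCommGroup (F i)]
  [∀ i, NormedSpace ℂ (F i)] {h : ∀ i, F i → ℝ} {w : ∀ i, F i}

theorem sepSum_pos_iff (hh : ∀ i, IsConditionIISummand (h i)) : 0 < sepSum h w ↔ w ≠ 0 := by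
  refine ⟨?_, fun hw => ?_⟩
  · rintro hpos rfl
    exact hpos.ne' (sepSum_eq_zero fun i => (hh i).admissible.apply_zero)
  · obtain ⟨i, hi⟩ := Function.ne_iff.1 hw
    exact Finset.sum_pos' (fun i _ => (hh i).admissible.nonneg _)
      ⟨i, Finset.mem_univ _, (hh i).admissible.pos hi⟩

theorem fderiv_sepSum_ne_zero_of_ne_zero (hh : ∀ i, IsConditionIISummand (h i)) (hw : w ≠ 0) :
    fderiv ℝ (sepSum h) w ≠ 0 := by
  obtain ⟨i, hi⟩ := Function.ne_iff.1 hw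
  exact fderiv_sepSum_ne_zero (fun i => ((hh i).contDiffAt (n := 1) _).differentiableAt one_ne_zero)
    ((hh i).admissible.gradient _ hi)

theorem levi_sepSum_nonneg (hh : ∀ i, IsConditionIISummand (h i)) (w u : ∀ i, F i) :
    0 ≤ levi (sepSum h) w u := by
  rw [levi_sepSum fun i => (hh i).contDiffAt (n := 2) _]
  exact Finset.sum_nonneg fun i _ => (hh i).levi_nonneg _ _

theorem norm_sq_del_sepSum_le_of_conditionII (hh : ∀ i, IsConditionIISummand (h i))
    (w u : ∀ i, F i) : ‖del (sepSum h) w u‖ ^ 2 ≤ sepSum h w * levi (sepSum h) w u :=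
  norm_sq_del_sepSum_le (fun i => (hh i).contDiffAt (n := 2) _)
    (fun i => (hh i).admissible.nonneg _) (fun i => (hh i).levi_nonneg _ _)
    fun i => (hh i).norm_sq_del_le _ _

theorem levi_sepSum_pos_of_forall_ne_zero (hh : ∀ i, IsConditionIISummand (h i))
    (hw : ∀ i, w i ≠ 0) {u : ∀ i, F i} (hu : u ≠ 0) : 0 < levi (sepSum h) w u :=
  levi_sepSum_pos (fun i => (hh i).contDiffAt (n := 2) _)
    (fun i => (hh i).strictPSH.2 _ (hw i)) hu

variable {E : Type*} [NormedAddCommGroup E] [NormedSpace ℂ E] {Ω U : Set E} {ρ : E → ℝ} {s : ℝ}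

theorem levi_prodFun_sepSum_pos (hρ : IsDefiningFunction Ω U ρ) (hs : IsDiederichFornaess Ω ρ s)
    (hh : ∀ i, IsConditionIISummand (h i)) {q : E × ∀ i, F i} (hU : q.1 ∈ U)
    (h0 : ρ q.1 + sepSum h q.2 = 0) (hq : q.2 ≠ 0) (hall : ∀ i, q.2 i ≠ 0) {t : E × ∀ i, F i}
    (ht : t ≠ 0) (htan : del (prodFun ρ (sepSum h)) q t = 0) :
    0 < levi (prodFun ρ (sepSum h)) q t := by
  have hpos : 0 < sepSum h q.2 := (sepSum_pos_iff hh).2 hq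
  exact levi_prodFun_pos hs.pos ((hρ.contDiffAt hU).of_le ENat.LEInfty.out)
    (fun _ => hs.levi_gt_of_neg hρ hU (by linarith))
    (contDiff_sepSum fun i => (hh i).admissible.smooth.of_le ENat.LEInfty.out).contDiffAt hpos
    (by simpa using norm_sq_del_sepSum_le_of_conditionII hh q.2)
    (fun _ => levi_sepSum_pos_of_forall_ne_zero hh hall) h0 ht htan

theorem typ_prodFun_sepSum [ProperSpace E] [∀ i, ProperSpace (F i)] [∀ i, Nontrivial (F i)]
    (hρ : IsDefiningFunction Ω U ρ) (hs : IsDiederichFornaess Ω ρ s)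
    (hh : ∀ i, IsConditionIISummand (h i)) {q : E × ∀ i, F i} (hU : q.1 ∈ U)
    (h0 : ρ q.1 + sepSum h q.2 = 0) (hq : q.2 ≠ 0) (hex : ∃ i, q.2 i = 0) :
    typ (prodFun ρ (sepSum h)) q = ⨆ (i : ι) (_ : q.2 i = 0), typ (h i) 0 := by
  classical
  let P : ι → Prop := fun i => q.2 i = 0
  let f := prodFun ρ (sepSum fun j : {i // ¬ P i} => h j)
  let b := sepSum fun j : {i // P i} => h j
  let p : E × ∀ j : {i // ¬ P i}, F j := (q.1, fun j => q.2 j)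
  have hqp : splitCoords E F P q = (p, 0) := Prod.ext rfl (funext fun j => j.2)
  have hb0 : b 0 = 0 := sepSum_eq_zero fun j => (hh j).admissible.apply_zero
  have hf0 : f p = 0 := by
    have hfb : prodFun f b (p, 0) = 0 :=
      hqp ▸ (prodFun_sepSum_eq_splitCoords P ρ h q).symm.trans h0
    rwa [prodFun, hb0, add_zero] at hfb
  have hp : p.2 ≠ 0 := fun hp => hq (funext fun i => by_contra fun hi => hi (congrFun hp ⟨i, hi⟩))
  have hsm : ∀ i, ContDiff ℝ ∞ (h i) := fun i => (hh i).admissible.smooth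
  have hb : ContDiffAt ℝ ∞ b 0 := ContDiff.contDiffAt (contDiff_sepSum fun j => hsm j)
  have hhJ : ∀ j : {i // ¬ P i}, IsConditionIISummand (h j) := fun j => hh j
  have hstrict : ∀ t ≠ 0, del f p t = 0 → 0 < levi f p t := fun _ =>
    levi_prodFun_sepSum_pos hρ hs hhJ hU hf0 hp Subtype.prop
  have : Nontrivial (∀ j : {i // P i}, F j) := hex.elim fun i hi => Pi.nontrivial_at ⟨i, hi⟩
  calc typ (prodFun ρ (sepSum h)) q = typ (prodFun f b) (p, 0) :=
        (typ_prodFun_sepSum_eq_typ_splitCoords P (hρ.contDiffAt hU) hsm).trans (by rw [hqp])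
    _ = typ b 0 := typ_prodFun_of_strict
        (contDiffAt_prodFun (hρ.contDiffAt hU)
          (ContDiff.contDiffAt (contDiff_sepSum fun j => hsm j))) hf0 hstrict hb hb0
        (sepSum_nonneg fun j => (hh j).admissible.nonneg)
        (norm_sq_del_sepSum_le_of_conditionII fun j => hh j)
    _ = ⨆ j : {i // P i}, typ (h j) 0 := typ_sepSum (fun j => hsm j)
        (fun j => (hh j).admissible.nonneg) fun j => (hh j).admissible.apply_zero
    _ = ⨆ (i : ι) (_ : q.2 i = 0), typ (h i) 0 := iSup_subtype

end ConditionII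

section HartogsDomainType

variable {E : Type*} [NormedAddCommGroup E] [NormedSpace ℂ E] {Ω U : Set E} {ρ : E → ℝ} {s : ℝ}

theorem isOfFiniteType_tilde_zero [CompleteSpace E] {F : Type*} [NormedAddCommGroup F]
    [NormedSpace ℂ F] [CompleteSpace F] {h : F → ℝ} (hρ : IsDefiningFunction Ω U ρ)
    (hs : IsDiederichFornaess Ω ρ s) (hh : ConditionI s h) {z₀ : E} (hz₀ : z₀ ∈ frontier Ω)
    {τ : ℝ≥0∞} (hτ : IsOfFiniteType Ω z₀ τ) (hfinite : typ h 0 < ⊤) :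
    IsOfFiniteType (tilde U ρ h) (z₀, 0) (max τ (typ h 0)) := by
  obtain ⟨hτ, r, hr, rfl⟩ := hτ
  obtain ⟨hadm, σ, hσ0, hσ, hpow⟩ := hh
  have hU : z₀ ∈ U := hρ.closure_subset hz₀.1
  have hloc : IsLocalDefiningFunction Ω z₀ ρ := hρ.isLocalDefiningFunction hz₀
  have hρ0 : ρ z₀ = 0 := by
    obtain ⟨-, -, -, -, -, hρ0, -⟩ := hloc
    exact hρ0
  refine ⟨max_lt hτ hfinite, prodFun ρ h, isLocalDefiningFunction_tilde hρ hadm.smooth hU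
    (by simp [hρ0, hadm.apply_zero]) (.inl (hρ.gradient _ hz₀)), ?_⟩
  have hρpow : ∀ᶠ z in 𝓝 z₀, ρ z < 0 → ∀ t, -(1 - s) * ‖del ρ z t‖ ^ 2 ≤ -ρ z * levi ρ z t := by
    filter_upwards [hρ.isOpen.mem_nhds hU] with z hz hneg t
    rcases eq_or_ne t 0 with rfl | ht
    · simp [levi_zero_right]
    · exact (hs.levi_gt_of_neg hρ hz hneg ht).le
  rw [typ_prodFun hσ0 hσ hs.le_one (hρ.contDiffAt hU) hρ0 hadm.smooth.contDiffAt hadm.apply_zero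
    (.of_forall hadm.nonneg) (.of_forall (hpow.norm_sq_del_le hadm hσ0)) hρpow, hloc.typ_eq hr]

variable {ι : Type*} [Fintype ι] {F : ι → Type*} [∀ i, NormedAddCommGroup (F i)]
  [∀ i, NormedSpace ℂ (F i)] {h : ∀ i, F i → ℝ} {q : E × ∀ i, F i}

theorem isPseudoconvex_tilde_sepSum (hρ : IsDefiningFunction Ω U ρ)
    (hs : IsDiederichFornaess Ω ρ s) (hh : ∀ i, IsConditionIISummand (h i)) :
    IsPseudoconvex (tilde U ρ (sepSum h)) :=
  isPseudoconvex_tilde hρ hs (contDiff_sepSum fun i => (hh i).admissible.smooth)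
    (sepSum_nonneg fun i => (hh i).admissible.nonneg) hs.pos
    (fun _ hw => fderiv_sepSum_ne_zero_of_ne_zero hh ((sepSum_pos_iff hh).1 hw))
    (by simpa using norm_sq_del_sepSum_le_of_conditionII hh) (levi_sepSum_nonneg hh)

theorem isOfFiniteType_tilde_sepSum [ProperSpace E] [∀ i, ProperSpace (F i)]
    [∀ i, Nontrivial (F i)] (hρ : IsDefiningFunction Ω U ρ) (hs : IsDiederichFornaess Ω ρ s)
    (hh : ∀ i, IsConditionIISummand (h i)) (hfinite : ∀ i, typ (h i) 0 < ⊤)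
    (hq : q ∈ frontier (tilde U ρ (sepSum h))) (hne : q.2 ≠ 0) (hex : ∃ i, q.2 i = 0) :
    IsOfFiniteType (tilde U ρ (sepSum h)) q (⨆ (i : ι) (_ : q.2 i = 0), typ (h i) 0) := by
  have hsm : ContDiff ℝ ∞ (sepSum h) := contDiff_sepSum fun i => (hh i).admissible.smooth
  obtain ⟨hcl, h0⟩ := mem_closure_of_mem_frontier_tilde hρ hsm.continuous
    (sepSum_nonneg fun i => (hh i).admissible.nonneg) hq
  have hU : q.1 ∈ U := hρ.closure_subset hcl
  refine ⟨?_, _, isLocalDefiningFunction_tilde hρ hsm hU h0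
    (.inr (fderiv_sepSum_ne_zero_of_ne_zero hh hne)), typ_prodFun_sepSum hρ hs hh hU h0 hne hex⟩
  rw [← Finset.sup_univ_eq_iSup, Finset.sup_lt_iff (by simp)]
  exact fun i _ => (iSup_le fun _ => le_rfl).trans_lt (hfinite i)

theorem isStrictPseudoconvexAt_tilde_sepSum (hρ : IsDefiningFunction Ω U ρ)
    (hs : IsDiederichFornaess Ω ρ s) (hh : ∀ i, IsConditionIISummand (h i))
    (hq : q ∈ frontier (tilde U ρ (sepSum h))) (hne : q.2 ≠ 0) (hall : ∀ i, q.2 i ≠ 0) :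
    IsStrictPseudoconvexAt (tilde U ρ (sepSum h)) q :=
  isStrictPseudoconvexAt_tilde hρ hs (contDiff_sepSum fun i => (hh i).admissible.smooth)
    (sepSum_nonneg fun i => (hh i).admissible.nonneg) hs.pos hq ((sepSum_pos_iff hh).2 hne)
    (fderiv_sepSum_ne_zero_of_ne_zero hh hne)
    (by simpa using norm_sq_del_sepSum_le_of_conditionII hh q.2)
    fun _ => levi_sepSum_pos_of_forall_ne_zero hh hall

theorem ConditionI.isStrictPseudoconvexAt_tilde {F : Type*} [NormedAddCommGroup F]
    [NormedSpace ℂ F] {h : F → ℝ} (hh : ConditionI s h) (hρ : IsDefiningFunction Ω U ρ)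
    (hs : IsDiederichFornaess Ω ρ s) (hstrict : IsStrictPSHOn h {0}ᶜ) {q : E × F}
    (hq : q ∈ frontier (tilde U ρ h)) (hne : q.2 ≠ 0) :
    IsStrictPseudoconvexAt (tilde U ρ h) q := by
  obtain ⟨hadm, σ, hσ0, hσ, hpow⟩ := hh
  exact Hartogs.isStrictPseudoconvexAt_tilde hρ hs hadm.smooth hadm.nonneg hσ hq (hadm.pos hne)
    (hadm.gradient _ hne) (hpow.norm_sq_del_le hadm hσ0 _) (hstrict.2 _ hne)

end HartogsDomainType

end Hartogs

open Hartogs in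
theorem mainTheorem7_general {E : Type*} [NormedAddCommGroup E] [NormedSpace ℂ E] [ProperSpace E]
    {Ω U : Set E} {ρ : E → ℝ} {s : ℝ} (hρ : IsDefiningFunction Ω U ρ)
    (hs : IsDiederichFornaess Ω ρ s) :
    (∀ (F : Type*) [NormedAddCommGroup F] [NormedSpace ℂ F] [CompleteSpace F] (h : F → ℝ),
      ConditionI s h →
      (∀ z₀ ∈ frontier Ω, ∀ τ : ℝ≥0∞, IsOfFiniteType Ω z₀ τ → typ h 0 < ⊤ →
        IsOfFiniteType (tilde U ρ h) (z₀, 0) (max τ (typ h 0))) ∧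
      (IsStrictPSHOn h {0}ᶜ → ∀ q ∈ frontier (tilde U ρ h), q.2 ≠ 0 →
        IsStrictPseudoconvexAt (tilde U ρ h) q)) ∧
    (∀ (ι : Type*) [Fintype ι] (F : ι → Type*) [∀ i, NormedAddCommGroup (F i)]
      [∀ i, NormedSpace ℂ (F i)] [∀ i, ProperSpace (F i)] [∀ i, Nontrivial (F i)]
      (h : ∀ i, F i → ℝ), (∀ i, IsConditionIISummand (h i)) → (∀ i, typ (h i) 0 < ⊤) →
      IsPseudoconvex (tilde U ρ (sepSum h)) ∧
      ∀ q ∈ frontier (tilde U ρ (sepSum h)), q.2 ≠ 0 →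
        ((∃ i, q.2 i = 0) → IsOfFiniteType (tilde U ρ (sepSum h)) q
          (⨆ (i : ι) (_ : q.2 i = 0), typ (h i) 0)) ∧
        ((∀ i, q.2 i ≠ 0) → IsStrictPseudoconvexAt (tilde U ρ (sepSum h)) q)) :=
  ⟨fun _ _ _ _ _ hh =>
    ⟨fun _ hz₀ _ hτ hfinite => isOfFiniteType_tilde_zero hρ hs hh hz₀ hτ hfinite,
      fun hstrict _ => hh.isStrictPseudoconvexAt_tilde hρ hs hstrict⟩,
    fun _ _ _ _ _ _ _ _ hh hfinite =>
      ⟨isPseudoconvex_tilde_sepSum hρ hs hh, fun _ hq hne =>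
        ⟨isOfFiniteType_tilde_sepSum hρ hs hh hfinite hq hne,
          isStrictPseudoconvexAt_tilde_sepSum hρ hs hh hq hne⟩⟩⟩

theorem mainTheorem7 (n : ℕ) (Ω U : Set (Hartogs.Cn n)) (ρ : Hartogs.Cn n → ℝ) (s : ℝ)
    (hΩ : Hartogs.IsSmoothBoundedPseudoconvexDomain Ω)
    (hρ : Hartogs.IsDefiningFunction Ω U ρ)
    (hs : Hartogs.IsDiederichFornaess Ω ρ s) :
    (∀ (m : ℕ) (h : Hartogs.Cn m → ℝ), Hartogs.ConditionI s h →
      (∀ z₀ ∈ frontier Ω, ∀ τ : ℝ≥0∞, Hartogs.IsOfFiniteType Ω z₀ τ → Hartogs.typ h 0 < ⊤ →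
        Hartogs.IsOfFiniteType (Hartogs.tilde U ρ h) (z₀, 0) (max τ (Hartogs.typ h 0))) ∧
      (Hartogs.IsStrictPSHOn h {0}ᶜ →
        ∀ q ∈ frontier (Hartogs.tilde U ρ h), q.2 ≠ 0 →
          Hartogs.IsStrictPseudoconvexAt (Hartogs.tilde U ρ h) q)) ∧
    (∀ (p : ℕ) (m : Fin p → ℕ) (h : ∀ i, Hartogs.Cn (m i) → ℝ), Hartogs.ConditionII h →
      Hartogs.IsPseudoconvex (Hartogs.tilde U ρ (Hartogs.sumFun h)) ∧
      ∀ q ∈ frontier (Hartogs.tilde U ρ (Hartogs.sumFun h)),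
        q.2 ≠ 0 →
          ((∃ i, q.2 i = 0) →
            Hartogs.IsOfFiniteType (Hartogs.tilde U ρ (Hartogs.sumFun h)) q
              (⨆ (i : Fin p) (_ : q.2 i = 0), Hartogs.typ (h i) 0)) ∧
          ((∀ i, q.2 i ≠ 0) →
            Hartogs.IsStrictPseudoconvexAt (Hartogs.tilde U ρ (Hartogs.sumFun h)) q)) :=
  let ⟨hI, hII⟩ := mainTheorem7_general hρ hs
  ⟨fun _ => hI _, fun _ _ h hh =>
    have _ i : NeZero _ := ⟨Nat.one_le_iff_ne_zero.1 (hh.dim_pos i)⟩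
    hII _ _ h (fun i => ⟨hh.admissible i, hh.psh i, hh.log_psh i, hh.strictPSH i⟩) hh.finiteType⟩
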